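/- Let $\mathcal K=\{z_0z_2=z_1^2\}\subset\mathbb P^2_{\mathbb C}$, a nonsingular conic (every nonsingular conic has this form in suitable coordinates), and let $\mathcal H=\mathcal K^{\{A,B,C,D,E,F\}}$ be the variety of maps $h$ from the six letters to $\mathcal K$. For a partition $\pi$ of the letters let $\Delta_\pi\subseteq\mathcal H$ be the set of $h$ that are constant on every block of $\pi$; its type is the list of block sizes of $\pi$. Let $\mathcal H^\circ$ be $\mathcal H$ with all $\Delta_\pi$ of type $(3,2,1)$ or $(4,1,1)$ removed. In $\mathcal H^\circ$ let $Z$ be the union of all $\Delta_\pi\cap\mathcal H^\circ$ of type $(2,2,2)$, and $Y$ the union of all $\Delta_\pi\cap\mathcal H^\circ$ of type $(2,2,1,1)$ or $(3,1,1,1)$. Let $\beta_1:\mathbb X'\to\mathcal H^\circ$ be the blow-up along $Z$, let $Y'=\overline{\beta_1^{-1}(Y\setminus Z)}$ be the proper transform of $Y$, let $\beta_2:\mathbb X\to\mathbb X'$ be the blow-up along $Y'$, and put $\beta=\beta_1\circ\beta_2$ and $X_h=\beta^{-1}(h)$. A Pascal symbol $s$ is an arrangement of the six letters in an array with two rows $(x_1,x_2,x_3)$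 and $(y_1,y_2,y_3)$, up to row and column shuffles. If $h$ is injective, its Pascal line $p_s(h)\in(\mathbb P^2)^*$ is the line that contains the three points $h(x_i)h(y_j)\cap h(x_j)h(y_i)$, $i<j$. This defines a rational map $p_s:\mathcal H^\circ\dashrightarrow(\mathbb P^2)^*$. Write $q_s$ for the regular extension of $p_s\circ\beta$ to open subsets of $\mathbb X$. **Proposition.** Let $M,P,Q,R$ be four distinct points of $\mathcal K$, and let $h\in\mathcal H$ be the map with $h(A)=h(B)=h(C)=M$, $h(D)=P$, $h(E)=Q$, $h(F)=R$. Let $s$ be a Pascal symbol in which $A,B,C$ form a single row. Then $X_h\cong\mathbb P^1$; the map $q_s$ is defined (and regular) on an open neighbourhood of $X_h$ in $\mathbb X$; and for every regular extension $q_s$ of $p_s\circ\beta$ to an open subset of $\mathbb X$ that contains $X_h$ (in particular to all of $\mathbb X$), $q_s$ restricts to an isomorphism of $X_h$ onto the pencil $\{L\in(\mathbb P^2)^*: M\in L\}$ of lines through $M$. -/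

import Mathlib

open Topology

noncomputable section

namespace PascalResolution

/-! ### Classical complex varieties, as spaces with regular functions -/

/-- A space with functions over `ℂ`: a (Zariski) topological space together with the knowledge of
which `ℂ`-valued functions are regular at which points.  Only the germ of `f` at `x` matters in
`RegAt f x` in each of the constructions below; values of `f` away from `x` are irrelevant. -/
structure FunSpace where
  carrier : Type
  top : TopologicalSpace carrier
  RegAt : (carrier → ℂ) → carrier → Prop

instance : CoeSort FunSpace Type := ⟨FunSpace.carrier⟩

instance (X : FunSpace) : TopologicalSpace X := X.top

/-- Morphisms: continuous maps that pull regular functions back to regular functions. -/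
def IsMorphism (X Y : FunSpace) (g : X → Y) : Prop :=
  Continuous g ∧ ∀ (x : X) (f : Y → ℂ), Y.RegAt f (g x) → X.RegAt (f ∘ g) x

/-- Isomorphisms: bijections that are morphisms in both directions. -/
structure Iso (X Y : FunSpace) where
  toEquiv : X ≃ Y
  isMorphism_toFun : IsMorphism X Y toEquiv
  isMorphism_invFun : IsMorphism Y X toEquiv.symm

/-- A subset (in practice: locally closed) with the induced topology; a function on it is regular
at a point if near that point it is the restriction of a regular function of the ambient space. -/
def FunSpace.sub (X : FunSpace) (S : Set X) : FunSpace where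
  carrier := S
  top := inferInstance
  RegAt f x := ∃ F : X → ℂ, X.RegAt F x.1 ∧ ∀ᶠ y : S in 𝓝 x, f y = F y.1

/-- The space whose points `a` have homogeneous coordinates `coord a`, the variable `i` having
(multi)degree `w i`.  The topology is the Zariski topology generated by the non-vanishing loci
of (multi)homogeneous polynomials, and the regular functions are locally the quotients `P / Q` of
(multi)homogeneous polynomials of the same (multi)degree with non-vanishing denominator. -/
def FunSpace.ofCoordinates {α σ M : Type} [AddCommMonoid M] (coord : α → σ → ℂ) (w : σ → M) :
    FunSpace where
  carrier := α
  top := TopologicalSpace.generateFrom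
    {U | ∃ (d : M) (Q : MvPolynomial σ ℂ), MvPolynomial.IsWeightedHomogeneous w Q d ∧
      U = {a | MvPolynomial.eval (coord a) Q ≠ 0}}
  RegAt f a := ∃ (d : M) (P Q : MvPolynomial σ ℂ),
    MvPolynomial.IsWeightedHomogeneous w P d ∧ MvPolynomial.IsWeightedHomogeneous w Q d ∧
    MvPolynomial.eval (coord a) Q ≠ 0 ∧
    ∃ (D : M) (S : MvPolynomial σ ℂ), MvPolynomial.IsWeightedHomogeneous w S D ∧
      MvPolynomial.eval (coord a) S ≠ 0 ∧
      ∀ b, MvPolynomial.eval (coord b) S ≠ 0 →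
        f b = MvPolynomial.eval (coord b) P / MvPolynomial.eval (coord b) Q

/-- Projective space of dimension `n - 1` over `ℂ`, as a variety. -/
def proj (n : ℕ) : FunSpace :=
  FunSpace.ofCoordinates (α := Projectivization ℂ (Fin n → ℂ)) (σ := Fin n) (M := ℕ)
    (fun z => z.rep) (fun _ => 1)

/-- The product of copies, indexed by `ι`, of projective space of dimension `n - 1` over `ℂ`,
as a variety; its forms are the multihomogeneous polynomials. -/
def multiProj (ι : Type) [DecidableEq ι] (n : ℕ) : FunSpace :=
  FunSpace.ofCoordinates (α := ι → Projectivization ℂ (Fin n → ℂ)) (σ := ι × Fin n)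
    (M := ι → ℕ) (fun z p => (z p.1).rep p.2) (fun p => Pi.single p.1 1)

/-! ### Blow-ups -/

/-- The stalk at `x` of the ideal sheaf of `Y`: the functions that are regular at `x` and vanish
on `Y` near `x` (represented by functions on all of `X`). -/
def FunSpace.idealAt (X : FunSpace) (Y : Set X) (x : X) : Set (X → ℂ) :=
  {f | X.RegAt f x ∧ ∀ᶠ y in 𝓝 x, y ∈ Y → f y = 0}

/-- The points of the blow-up `Proj (⨁ₙ Iⁿ)` of `X` along the ideal sheaf `I` of `Y`.  A point
above `x` is a graded homomorphism, up to scaling, from the Rees algebra `⨁ₙ Iₓⁿ` to `ℂ[t]` that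
is evaluation at `x` in degree `0` and is non-zero in degree `1`.  As the Rees algebra is generated
in degree `1`, it is given by its degree-one part `ℓ : Iₓ → ℂ` (extended by zero to functions
that are not in `Iₓ`), which has to be compatible with evaluation at `x` and with all homogeneous
polynomial relations in `Iₓ`. -/
structure BlowUpPoint (X : FunSpace) (Y : Set X) where
  /-- the image under the structure morphism -/
  base : X
  /-- the class of `ℓ` up to scaling -/
  dir : Projectivization ℂ ((X → ℂ) → ℂ)
  support : ∀ f, f ∉ X.idealAt Y base → dir.rep f = 0
  semilinear : ∀ (c f g : X → ℂ), X.RegAt c base → f ∈ X.idealAt Y base →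
    g ∈ X.idealAt Y base → (∀ᶠ y in 𝓝 base, g y = c y * f y) → dir.rep g = c base * dir.rep f
  relation : ∀ (n d : ℕ) (f : Fin n → X → ℂ) (P : MvPolynomial (Fin n) ℂ),
    (∀ i, f i ∈ X.idealAt Y base) → P.IsHomogeneous d →
    (∀ᶠ y in 𝓝 base, MvPolynomial.eval (fun i => f i y) P = 0) →
    MvPolynomial.eval (fun i => dir.rep (f i)) P = 0

/-- The value at a point of the blow-up of the homogeneous element `P(f₁, …, fₙ)` of the Rees
algebra (well defined up to the `d`-th power of a scalar, `d` the degree of `P`). -/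
def BlowUpPoint.value {X : FunSpace} {Y : Set X} (ξ : BlowUpPoint X Y) {n : ℕ}
    (f : Fin n → X → ℂ) (P : MvPolynomial (Fin n) ℂ) : ℂ :=
  MvPolynomial.eval (fun i => ξ.dir.rep (f i)) P

/-- The basic open sets of the blow-up: over an open set `U` of `X`, the locus where a homogeneous
element `P(f₁, …, fₙ)` of the Rees algebra of `I` on `U` does not vanish. -/
def blowUpBasicOpen {X : FunSpace} {Y : Set X} (U : Set X) {n : ℕ} (f : Fin n → X → ℂ)
    (P : MvPolynomial (Fin n) ℂ) : Set (BlowUpPoint X Y) :=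
  {ξ | ξ.base ∈ U ∧ ξ.value f P ≠ 0}

/-- The Zariski topology of the blow-up. -/
def blowUpTopology (X : FunSpace) (Y : Set X) : TopologicalSpace (BlowUpPoint X Y) :=
  TopologicalSpace.generateFrom
    {V | ∃ (U : Set X) (n d : ℕ) (f : Fin n → X → ℂ) (P : MvPolynomial (Fin n) ℂ),
      IsOpen U ∧ (∀ y ∈ U, ∀ i, f i ∈ X.idealAt Y y) ∧ P.IsHomogeneous d ∧
      V = blowUpBasicOpen U f P}

/-- The blow-up of `X` along `Y` (with its reduced structure), `Proj (⨁ₙ Iⁿ)`: a function is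
regular if it is locally a quotient of two elements of the Rees algebra, homogeneous of the same
degree, with non-vanishing denominator. -/
def FunSpace.blowUp (X : FunSpace) (Y : Set X) : FunSpace where
  carrier := BlowUpPoint X Y
  top := blowUpTopology X Y
  RegAt F ξ := ∃ (n d : ℕ) (f : Fin n → X → ℂ) (P Q : MvPolynomial (Fin n) ℂ),
    (∀ i, f i ∈ X.idealAt Y ξ.base) ∧ P.IsHomogeneous d ∧ Q.IsHomogeneous d ∧
    ξ.value f Q ≠ 0 ∧
    ∀ᶠ η in @nhds _ (blowUpTopology X Y) ξ, F η = η.value f P / η.value f Q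

/-- The structure morphism of the blow-up. -/
def FunSpace.blowDown (X : FunSpace) (Y : Set X) : X.blowUp Y → X := fun ξ => BlowUpPoint.base ξ

/-! ### Sextuples on the conic, polydiagonals, and the resolution -/

inductive Letter
  | A | B | C | D | E | F
  deriving DecidableEq

instance : Fintype Letter where
  elems := {Letter.A, Letter.B, Letter.C, Letter.D, Letter.E, Letter.F}
  complete x := by cases x <;> simp

/-- The points of the complex projective plane. -/
abbrev Plane : Type := Projectivization ℂ (Fin 3 → ℂ)

/-- The conic `z₀ z₂ = z₁²`. -/
def conic : Set Plane := {z | z.rep 0 * z.rep 2 = z.rep 1 ^ 2}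

/-- The type of a partition of the letters: the multiset of the sizes of its blocks. -/
def partitionType (π : Finpartition (Finset.univ : Finset Letter)) : Multiset ℕ :=
  π.parts.val.map Finset.card

/-- The polydiagonal of a partition: `h` takes the same value on letters of the same block. -/
def polydiagonal (π : Finpartition (Finset.univ : Finset Letter)) : Set (Letter → Plane) :=
  {h | ∀ b ∈ π.parts, ∀ x ∈ b, ∀ y ∈ b, h x = h y}

/-- The union of all polydiagonals of a given type. -/
def polydiagonalsOfType (t : Multiset ℕ) : Set (Letter → Plane) :=
  {h | ∃ π, partitionType π = t ∧ h ∈ polydiagonal π}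

/-- The variety of sextuples of points on the conic, with the polydiagonals of type `(3,2,1)` or
`(4,1,1)` removed. -/
def openSextuples : FunSpace :=
  (multiProj Letter 3).sub
    {h : Letter → Plane | (∀ x, h x ∈ conic) ∧
      h ∉ polydiagonalsOfType {3, 2, 1} ∧ h ∉ polydiagonalsOfType {4, 1, 1}}

/-- The sextuple of points underlying a point of `openSextuples`. -/
def sextuple (h : openSextuples) : Letter → Plane := h.1

/-- The union of the open polydiagonals of type `(2,2,2)`. -/
def centreZ : Set openSextuples := {h | sextuple h ∈ polydiagonalsOfType {2, 2, 2}}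

/-- The union of the open polydiagonals of type `(2,2,1,1)` or `(3,1,1,1)`. -/
def centreY : Set openSextuples :=
  {h | sextuple h ∈ polydiagonalsOfType {2, 2, 1, 1} ∨
    sextuple h ∈ polydiagonalsOfType {3, 1, 1, 1}}

/-- The first blow-up, along `centreZ`. -/
def firstBlowUp : FunSpace := openSextuples.blowUp centreZ

/-- The structure morphism of the first blow-up. -/
def beta₁ : firstBlowUp → openSextuples := openSextuples.blowDown centreZ

/-- The proper transform of `centreY` in the first blow-up. -/
def properTransformY : Set firstBlowUp := closure (beta₁ ⁻¹' (centreY \ centreZ))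

/-- The iterated blow-up: the first blow-up, blown up along the proper transform of `centreY`. -/
def resolution : FunSpace := firstBlowUp.blowUp properTransformY

/-- The structure morphism of the second blow-up. -/
def beta₂ : resolution → firstBlowUp := firstBlowUp.blowDown properTransformY

/-- The composite structure morphism. -/
def beta (ξ : resolution) : openSextuples := beta₁ (beta₂ ξ)

/-- The fibre of `beta` over a sextuple. -/
def fibre (h : Letter → Plane) : Set resolution := {ξ | sextuple (beta ξ) = h}

/-! ### Pascal lines -/

/-- An array of the six letters in two rows and three columns.  Pascal symbols are such arrays up to
row and column shuffles, which change nothing in the definitions below. -/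
abbrev PascalArray : Type := Fin 2 × Fin 3 ≃ Letter

/-- The letters `A`, `B`, `C` are in a single row of the array. -/
def ABCInOneRow (s : PascalArray) : Prop :=
  ∃ r : Fin 2, (s.symm Letter.A).1 = r ∧ (s.symm Letter.B).1 = r ∧ (s.symm Letter.C).1 = r

/-- The line with coordinates `L` (a point of the dual plane) is the Pascal line of the six
distinct points `h`, arranged as in `s`: it contains the three cross-hair intersection points of
the line joining `s(0,i)` and `s(1,j)` with the line joining `s(0,j)` and `s(1,i)`.  (The line
joining two distinct points and the intersection of two distinct lines are both given by the
cross product, and incidence of points and lines is orthogonality.) -/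
def IsPascalLine (s : PascalArray) (h : Letter → Plane) (L : Plane) : Prop :=
  ∀ i j : Fin 3, i ≠ j →
    L.orthogonal
      (Projectivization.cross
        (Projectivization.cross (h (s (0, i))) (h (s (1, j))))
        (Projectivization.cross (h (s (0, j))) (h (s (1, i)))))

/-- `q` is, on the open set `W` of the resolution, a regular extension of the rational map that
sends a sextuple of distinct points to its Pascal line. -/
def IsPascalMorphismOn (s : PascalArray) (W : Set resolution) (q : resolution → proj 3) : Prop :=
  IsOpen W ∧
  IsMorphism (resolution.sub W) (proj 3) (fun ξ => q ξ.1) ∧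
  ∀ ξ ∈ W, Function.Injective (sextuple (beta ξ)) → IsPascalLine s (sextuple (beta ξ)) (q ξ)

/-- The pencil of lines through a point `M`, in the dual projective plane. -/
def pencil (M : Plane) : Set (proj 3) := {L : Plane | L.orthogonal M}

end PascalResolution

end

open PascalResolution

noncomputable section

namespace PascalResolution

open MvPolynomial Filter

/-! ### Spaces with homogeneous coordinates -/

/-! The conic minus one point, chosen away from the six given ones, is an affine line, so near `h`
the six parameters of the letters are coordinates. In this chart only A, B, C can coincide. Hence Z
is not met, the first blow-up changes nothing, and Y is the diagonal t_A = t_B = t_C, smooth of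
codimension two. Two differences of parameters generate its ideal, and their values are homogeneous
coordinates on the fibre of the second blow-up, which is therefore a projective line
(`Chart.exists_iso_fibre`).

Let x be the parameters of the row A, B, C, let y be those of the other row, and let ℓ(t, u) be the
chord of the conic. Up to a common factor the Pascal line is (x₀ - x₂)(y₂ - y₁) ℓ(x₁, y₀) + (x₁ -
x₂)(y₀ - y₂) ℓ(x₀, y₁) (`pascalLine`, `orthogonal_crossHair_iff`). Its coordinates lie in the ideal
of the diagonal, that is, in degree one of the Rees algebra, and define a morphism wherever they
have no common zero. Over x₀ = x₁ = x₂ = m the two differences become the coordinates of the fibre.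
Their coefficients become non-zero multiples of the chords joining M to the points y₀ and y₁, a
basis of the lines through M. So this extension maps the fibre linearly and isomorphically onto the
pencil (`injective_pencilMap`, `mem_range_pencilMap`, `exists_iso_pencil`).

Any other extension agrees with this one on the fibre: each point of the fibre is the limit of a
curve of injective sextuples along which regular functions converge (`Chart.exists_curve`), the
Pascal line of an injective sextuple is unique, and limits in ℂ are unique
(`eq_of_eventually_eq_curve`). The same curves produce the points of the fibre, as functionals lim
f/ε on the ideal. The Euclidean topology enters through the local inverse `τ` of a `Chart`. -/

theorem eval_scale_of_isWeightedHomogeneous {σ M : Type} [AddCommMonoid M] {w : σ → M}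
    {P : MvPolynomial σ ℂ} {d : M} (hP : IsWeightedHomogeneous w P d)
    (χ : Multiplicative M →* ℂ) (a : σ → ℂ) :
    eval (fun i => χ (.ofAdd (w i)) * a i) P = χ (.ofAdd d) * eval a P := by
  rw [eval_eq, eval_eq, Finset.mul_sum]
  refine Finset.sum_congr rfl fun m hm => ?_
  have h1 : Finsupp.weight w m = d := hP (mem_support_iff.1 hm)
  have h2 : χ (.ofAdd d) = ∏ i ∈ m.support, χ (.ofAdd (w i)) ^ m i := by
    rw [← h1, Finsupp.weight_apply, Finsupp.sum, ofAdd_sum, map_prod]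
    simp [ofAdd_nsmul]
  simp only [mul_pow, Finset.prod_mul_distrib, h2]
  ring

theorem eval_smul_of_isHomogeneous {σ : Type} {P : MvPolynomial σ ℂ} {d : ℕ}
    (hP : P.IsHomogeneous d) (c : ℂ) (a : σ → ℂ) :
    eval (fun i => c * a i) P = c ^ d * eval a P := by
  simpa [powersHom_apply] using eval_scale_of_isWeightedHomogeneous hP (powersHom ℂ c) a

section Coordinates

variable {α σ M : Type} [AddCommMonoid M] {coord : α → σ → ℂ} {w : σ → M}

/-- The product of two forms is a form, so non-vanishing loci are stable under intersection. A
neighbourhood can then be tested with a single form, and the explicit `S` in `RegAt` becomes a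
statement about germs. -/
theorem isTopologicalBasis_ofCoordinates :
    TopologicalSpace.IsTopologicalBasis (α := FunSpace.ofCoordinates coord w)
      {U | ∃ (d : M) (Q : MvPolynomial σ ℂ), IsWeightedHomogeneous w Q d ∧
        U = {a | eval (coord a) Q ≠ 0}} where
  exists_subset_inter := by
    rintro _ ⟨d, Q, hQ, rfl⟩ _ ⟨e, S, hS, rfl⟩ x hx
    refine ⟨_, ⟨_, _, hQ.mul hS, rfl⟩, ?_, ?_⟩
    · change eval (coord x) (Q * S) ≠ 0
      rw [map_mul]
      exact mul_ne_zero hx.1 hx.2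
    · intro y hy
      change eval (coord y) (Q * S) ≠ 0 at hy
      rw [map_mul] at hy
      exact ⟨left_ne_zero_of_mul hy, right_ne_zero_of_mul hy⟩
  sUnion_eq := Set.eq_univ_of_forall fun x =>
    Set.mem_sUnion.2 ⟨_, ⟨0, 1, isWeightedHomogeneous_one ℂ w, rfl⟩, by
      change eval (coord x) (1 : MvPolynomial σ ℂ) ≠ 0
      simp⟩
  eq_generateFrom := rfl

theorem eventually_ofCoordinates {a : FunSpace.ofCoordinates coord w}
    {p : FunSpace.ofCoordinates coord w → Prop} :
    (∀ᶠ b in 𝓝 a, p b) ↔ ∃ (d : M) (S : MvPolynomial σ ℂ), IsWeightedHomogeneous w S d ∧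
      eval (coord a) S ≠ 0 ∧ ∀ b, eval (coord b) S ≠ 0 → p b := by
  rw [Filter.Eventually, isTopologicalBasis_ofCoordinates.mem_nhds_iff]
  constructor
  · rintro ⟨_, ⟨d, S, hS, rfl⟩, h1, h2⟩
    exact ⟨d, S, hS, h1, fun b hb => h2 hb⟩
  · rintro ⟨d, S, hS, h1, h2⟩
    exact ⟨_, ⟨d, S, hS, rfl⟩, h1, fun b hb => h2 b hb⟩

theorem eventually_eval_ne_zero {a : FunSpace.ofCoordinates coord w} {d : M}
    {S : MvPolynomial σ ℂ} (hS : IsWeightedHomogeneous w S d) (ha : eval (coord a) S ≠ 0) :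
    ∀ᶠ b : FunSpace.ofCoordinates coord w in 𝓝 a, eval (coord b) S ≠ 0 :=
  eventually_ofCoordinates.2 ⟨d, S, hS, ha, fun _ hb => hb⟩

theorem regAt_ofCoordinates {a : FunSpace.ofCoordinates coord w}
    {f : FunSpace.ofCoordinates coord w → ℂ} :
    (FunSpace.ofCoordinates coord w).RegAt f a ↔
      ∃ (d : M) (P Q : MvPolynomial σ ℂ), IsWeightedHomogeneous w P d ∧
        IsWeightedHomogeneous w Q d ∧ eval (coord a) Q ≠ 0 ∧
        ∀ᶠ b in 𝓝 a, f b = eval (coord b) P / eval (coord b) Q := by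
  simp only [eventually_ofCoordinates]
  rfl

theorem regAt_const (a : FunSpace.ofCoordinates coord w) (c : ℂ) :
    (FunSpace.ofCoordinates coord w).RegAt (fun _ => c) a :=
  regAt_ofCoordinates.2 ⟨0, C c, 1, isWeightedHomogeneous_C w c, isWeightedHomogeneous_one ℂ w,
    by simp, by simp⟩

variable {a : FunSpace.ofCoordinates coord w} {f g : FunSpace.ofCoordinates coord w → ℂ}

theorem RegAt.add (hf : (FunSpace.ofCoordinates coord w).RegAt f a)
    (hg : (FunSpace.ofCoordinates coord w).RegAt g a) :
    (FunSpace.ofCoordinates coord w).RegAt (fun b => f b + g b) a := by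
  obtain ⟨d, P, Q, hP, hQ, h0, h⟩ := regAt_ofCoordinates.1 hf
  obtain ⟨e, P', Q', hP', hQ', h0', h'⟩ := regAt_ofCoordinates.1 hg
  refine regAt_ofCoordinates.2 ⟨d + e, P * Q' + Q * P', Q * Q', (hP.mul hQ').add (hQ.mul hP'),
    hQ.mul hQ', by simp [h0, h0'], ?_⟩
  filter_upwards [h, h', eventually_eval_ne_zero hQ h0, eventually_eval_ne_zero hQ' h0']
    with b hb hb' h1 h2
  rw [hb, hb', div_add_div _ _ h1 h2]
  simp

theorem RegAt.mul (hf : (FunSpace.ofCoordinates coord w).RegAt f a)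
    (hg : (FunSpace.ofCoordinates coord w).RegAt g a) :
    (FunSpace.ofCoordinates coord w).RegAt (fun b => f b * g b) a := by
  obtain ⟨d, P, Q, hP, hQ, h0, h⟩ := regAt_ofCoordinates.1 hf
  obtain ⟨e, P', Q', hP', hQ', h0', h'⟩ := regAt_ofCoordinates.1 hg
  refine regAt_ofCoordinates.2 ⟨d + e, P * P', Q * Q', hP.mul hP',
    hQ.mul hQ', by simp [h0, h0'], ?_⟩
  filter_upwards [h, h'] with b hb hb'
  rw [hb, hb', div_mul_div_comm]
  simp

theorem RegAt.inv (hf : (FunSpace.ofCoordinates coord w).RegAt f a) (hfa : f a ≠ 0) :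
    (FunSpace.ofCoordinates coord w).RegAt (fun b => (f b)⁻¹) a := by
  obtain ⟨d, P, Q, hP, hQ, h0, h⟩ := regAt_ofCoordinates.1 hf
  refine regAt_ofCoordinates.2 ⟨d, Q, P, hQ, hP, ?_, ?_⟩
  · rw [h.self_of_nhds] at hfa
    exact fun h => hfa (by simp [h])
  · filter_upwards [h] with b hb
    rw [hb, inv_div]

theorem RegAt.eventually_ne_zero (hf : (FunSpace.ofCoordinates coord w).RegAt f a)
    (hfa : f a ≠ 0) : ∀ᶠ b in 𝓝 a, f b ≠ 0 := by
  obtain ⟨d, P, Q, hP, hQ, h0, h⟩ := regAt_ofCoordinates.1 hf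
  have hPa : eval (coord a) P ≠ 0 := by
    rw [h.self_of_nhds] at hfa
    exact fun h => hfa (by simp [h])
  filter_upwards [h, eventually_eval_ne_zero hQ h0, eventually_eval_ne_zero hP hPa]
    with b hb h1 h2
  rw [hb]
  exact div_ne_zero h2 h1

theorem RegAt.eval {ι : Type} {u : ι → FunSpace.ofCoordinates coord w → ℂ}
    (hu : ∀ i, (FunSpace.ofCoordinates coord w).RegAt (u i) a) (P : MvPolynomial ι ℂ) :
    (FunSpace.ofCoordinates coord w).RegAt (fun b => MvPolynomial.eval (fun i => u i b) P) a := by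
  induction P using MvPolynomial.induction_on with
  | C c => simpa using regAt_const a c
  | add p q hp hq => simpa using RegAt.add hp hq
  | mul_X p i hp => simpa using RegAt.mul hp (hu i)

end Coordinates

/-! ### Projective spaces -/

/-- `rep` is an arbitrary choice of representative; all computations with it go through this unknown
scalar, which cancels by homogeneity. -/
theorem rep_mk_eq_mul {σ : Type} (v : σ → ℂ) (hv : v ≠ 0) :
    ∃ c : ℂ, c ≠ 0 ∧ ∀ i, (Projectivization.mk ℂ v hv).rep i = c * v i := by
  obtain ⟨a, ha⟩ := Projectivization.exists_smul_eq_mk_rep ℂ v hv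
  exact ⟨a, a.ne_zero, fun i => by rw [← ha]; rfl⟩

theorem eval_rep_mk {σ : Type} {P : MvPolynomial σ ℂ} {d : ℕ} (hP : P.IsHomogeneous d)
    (v : σ → ℂ) (hv : v ≠ 0) : ∃ c : ℂ, c ≠ 0 ∧
      (∀ i, (Projectivization.mk ℂ v hv).rep i = c * v i) ∧
      eval (Projectivization.mk ℂ v hv).rep P = c ^ d * eval v P := by
  obtain ⟨c, hc, h⟩ := rep_mk_eq_mul v hv
  refine ⟨c, hc, h, ?_⟩
  rw [← eval_smul_of_isHomogeneous hP, ← funext h]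

theorem eval_rep_mk_div {σ : Type} {P Q : MvPolynomial σ ℂ} {d : ℕ} (hP : P.IsHomogeneous d)
    (hQ : Q.IsHomogeneous d) (v : σ → ℂ) (hv : v ≠ 0) :
    eval (Projectivization.mk ℂ v hv).rep P / eval (Projectivization.mk ℂ v hv).rep Q =
      eval v P / eval v Q := by
  obtain ⟨c, hc, h⟩ := rep_mk_eq_mul v hv
  rw [funext h, eval_smul_of_isHomogeneous hP, eval_smul_of_isHomogeneous hQ]
  exact mul_div_mul_left _ _ (pow_ne_zero _ hc)

theorem eval_rep_mk_ne_zero {σ : Type} {P : MvPolynomial σ ℂ} {d : ℕ} (hP : P.IsHomogeneous d)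
    (v : σ → ℂ) (hv : v ≠ 0) : eval (Projectivization.mk ℂ v hv).rep P ≠ 0 ↔ eval v P ≠ 0 := by
  obtain ⟨c, hc, -, h⟩ := eval_rep_mk hP v hv
  simp [h, hc]

/-- Substitution of linear forms. -/
theorem exists_isHomogeneous_comp_linear {m n d : ℕ} (T : (Fin m → ℂ) →ₗ[ℂ] (Fin n → ℂ))
    {P : MvPolynomial (Fin n) ℂ} (hP : P.IsHomogeneous d) :
    ∃ P' : MvPolynomial (Fin m) ℂ, P'.IsHomogeneous d ∧ ∀ v, eval v P' = eval (T v) P := by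
  have hlin : ∀ i, (∑ j, C (T (Pi.single j 1) i) * X j : MvPolynomial (Fin m) ℂ).IsHomogeneous 1 :=
    fun i => IsHomogeneous.sum _ _ _ fun j _ => (isHomogeneous_X ℂ j).C_mul _
  refine ⟨bind₁ (fun i => ∑ j, C (T (Pi.single j 1) i) * X j) P, ?_, fun v => ?_⟩
  · simpa using hP.aeval _ hlin
  · rw [← MvPolynomial.aeval_eq_eval, ← MvPolynomial.aeval_eq_eval]
    simp only [aeval_bind₁]
    congr 2
    funext i
    have h : v = ∑ j, v j • (Pi.single j 1 : Fin m → ℂ) := by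
      funext k
      simp [Finset.sum_apply, Pi.single_apply]
    conv_rhs => rw [h]
    simp [Finset.sum_apply, mul_comm]

theorem continuous_proj {X : FunSpace} {n : ℕ} {g : X → proj n}
    (h : ∀ (d : ℕ) (Q : MvPolynomial (Fin n) ℂ), Q.IsHomogeneous d →
      IsOpen {x | eval (Projectivization.rep (g x)) Q ≠ 0}) : Continuous g := by
  refine continuous_generateFrom_iff.2 ?_
  rintro _ ⟨d, Q, hQ, rfl⟩
  exact h d Q hQ

theorem regAt_proj {n : ℕ} {z : proj n} {f : proj n → ℂ} :
    (proj n).RegAt f z ↔ ∃ (d : ℕ) (P Q : MvPolynomial (Fin n) ℂ), P.IsHomogeneous d ∧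
      Q.IsHomogeneous d ∧ eval (Projectivization.rep z) Q ≠ 0 ∧
      ∀ᶠ y in 𝓝 z, f y = eval (Projectivization.rep y) P / eval (Projectivization.rep y) Q :=
  regAt_ofCoordinates

theorem isOpen_proj {n d : ℕ} {Q : MvPolynomial (Fin n) ℂ} (hQ : Q.IsHomogeneous d) :
    IsOpen {z : proj n | eval (Projectivization.rep z) Q ≠ 0} :=
  TopologicalSpace.isOpen_generateFrom_of_mem ⟨d, Q, hQ, rfl⟩

/-! ### Morphisms -/

theorem IsMorphism.comp {X Y Z : FunSpace} {g : Y → Z} {f : X → Y} (hg : IsMorphism Y Z g)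
    (hf : IsMorphism X Y f) : IsMorphism X Z (g ∘ f) :=
  ⟨hg.1.comp hf.1, fun x φ hφ => hf.2 x _ (hg.2 (f x) φ hφ)⟩

/-- The composite of two isomorphisms. -/
def Iso.trans {X Y Z : FunSpace} (e : Iso X Y) (f : Iso Y Z) : Iso X Z where
  toEquiv := e.toEquiv.trans f.toEquiv
  isMorphism_toFun := f.isMorphism_toFun.comp e.isMorphism_toFun
  isMorphism_invFun := e.isMorphism_invFun.comp f.isMorphism_invFun

/-- Spaces in which regularity of a function at a point depends only on its germ. -/
def FunSpace.IsLocal (X : FunSpace) : Prop :=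
  ∀ (x : X) (f g : X → ℂ), X.RegAt f x → (∀ᶠ y in 𝓝 x, g y = f y) → X.RegAt g x

theorem isLocal_proj (n : ℕ) : (proj n).IsLocal := by
  intro z f g hf hg
  obtain ⟨d, P, Q, hP, hQ, h0, h⟩ := regAt_proj.1 hf
  refine regAt_proj.2 ⟨d, P, Q, hP, hQ, h0, ?_⟩
  filter_upwards [h, hg] with y h1 h2
  rw [h2, h1]

theorem isMorphism_subtype_val (X : FunSpace) (S : Set X) :
    IsMorphism (X.sub S) X (fun x => x.1) :=
  ⟨continuous_subtype_val, fun _ f hf => ⟨f, hf, Eventually.of_forall fun _ => rfl⟩⟩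

/-- A morphism with values in a subset, as a morphism to the subset. -/
theorem IsMorphism.codRestrict {X Y : FunSpace} (hX : X.IsLocal) {S : Set Y} {g : X → Y.sub S}
    (hg : IsMorphism X Y (fun x => (g x).1)) : IsMorphism X (Y.sub S) g := by
  have hc : Continuous g := Continuous.subtype_mk hg.1 _
  refine ⟨hc, ?_⟩
  rintro x f ⟨F, hF, h⟩
  refine hX _ _ _ (hg.2 x F hF) ?_
  exact (hc.tendsto x).eventually h

/-- An injective linear map induces an isomorphism of a projective space onto the image. -/
theorem exists_iso_of_injective {m n : ℕ} (T : (Fin m → ℂ) →ₗ[ℂ] (Fin n → ℂ))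
    (hT : Function.Injective T) (S : Set (proj n))
    (hS : ∀ v hv, (Projectivization.mk ℂ v hv : proj n) ∈ S ↔ v ∈ LinearMap.range T) :
    ∃ e : Iso (proj m) ((proj n).sub S), ∀ (v : Fin m → ℂ) (hv : v ≠ 0),
      ∃ hv', (e.toEquiv (Projectivization.mk ℂ v hv : proj m)).1 =
        (Projectivization.mk ℂ (T v) hv' : proj n) := by
  -- A linear left inverse `A` of `T` is given by linear forms as well. It inverts `T` on `S`, which
  -- is the image of `T`.
  obtain ⟨A, hA⟩ := T.exists_leftInverse_of_injective (LinearMap.ker_eq_bot.2 hT)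
  have hA' : ∀ v, A (T v) = v := fun v => LinearMap.congr_fun hA v
  have hT0 : ∀ v, v ≠ 0 → T v ≠ 0 := fun v hv h => hv (hT (by simpa using h))
  have hmem : ∀ z : proj m, (Projectivization.mk ℂ (T (Projectivization.rep z))
      (hT0 _ (Projectivization.rep_nonzero z)) : proj n) ∈ S :=
    fun z => (hS _ _).2 ⟨_, rfl⟩
  have hS' : ∀ z : proj n, z ∈ S → ∃ v, T v = Projectivization.rep z := fun z hz =>
    (hS _ (Projectivization.rep_nonzero z)).1
      (by rw [show Projectivization.mk ℂ _ _ = z from Projectivization.mk_rep z]; exact hz)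
  have hA0 : ∀ z : proj n, z ∈ S → A (Projectivization.rep z) ≠ 0 := by
    intro z hz h
    obtain ⟨v, hv⟩ := hS' z hz
    rw [← hv, hA'] at h
    exact Projectivization.rep_nonzero z (by rw [← hv, h, map_zero])
  let e : proj m ≃ (proj n).sub S :=
    { toFun := fun z => ⟨Projectivization.mk ℂ (T (Projectivization.rep z)) _, hmem z⟩
      invFun := fun z => Projectivization.mk ℂ (A (Projectivization.rep z.1)) (hA0 z.1 z.2)
      left_inv := by
        intro z
        obtain ⟨a, ha⟩ := Projectivization.exists_smul_eq_mk_rep ℂ (T (Projectivization.rep z))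
          (hT0 _ (Projectivization.rep_nonzero z))
        conv_rhs => rw [show z = Projectivization.mk ℂ _ _ from (Projectivization.mk_rep z).symm]
        refine (Projectivization.mk_eq_mk_iff ℂ _ _ _ _).2 ⟨a, ?_⟩
        rw [← ha, A.map_smul_of_tower, hA']
      right_inv := by
        rintro ⟨z, hz⟩
        refine Subtype.ext ?_
        obtain ⟨a, ha⟩ := Projectivization.exists_smul_eq_mk_rep ℂ (A (Projectivization.rep z))
          (hA0 z hz)
        obtain ⟨v, hv⟩ := hS' z hz
        refine Eq.trans ((Projectivization.mk_eq_mk_iff ℂ _ _ _ _).2 ⟨a, ?_⟩)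
          (Projectivization.mk_rep z)
        rw [← ha, T.map_smul_of_tower, ← hv, hA'] }
  refine ⟨⟨e, ?_, ?_⟩, ?_⟩
  · refine IsMorphism.codRestrict (isLocal_proj m) ?_
    have hc : Continuous (fun z => (e z).1 : proj m → proj n) := by
      refine continuous_proj fun d Q hQ => ?_
      obtain ⟨Q', hQ', h⟩ := exists_isHomogeneous_comp_linear T hQ
      convert isOpen_proj hQ' using 3 with z
      rw [h]
      exact eval_rep_mk_ne_zero hQ _ _
    refine ⟨hc, fun z f hf => ?_⟩
    obtain ⟨d, P, Q, hP, hQ, h0, h⟩ := regAt_proj.1 hf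
    obtain ⟨P', hP', hPe⟩ := exists_isHomogeneous_comp_linear T hP
    obtain ⟨Q', hQ', hQe⟩ := exists_isHomogeneous_comp_linear T hQ
    refine regAt_proj.2 ⟨d, P', Q', hP', hQ', ?_, ?_⟩
    · rw [hQe]
      exact (eval_rep_mk_ne_zero hQ _ _).1 h0
    · filter_upwards [(hc.tendsto z).eventually h] with y hy
      rw [Function.comp, hy, hPe, hQe]
      exact eval_rep_mk_div hP hQ _ _
  · have hc : Continuous (e.symm : (proj n).sub S → proj m) := by
      refine continuous_proj (X := (proj n).sub S) fun d Q hQ => ?_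
      obtain ⟨Q', hQ', h⟩ := exists_isHomogeneous_comp_linear A hQ
      convert (isOpen_proj hQ').preimage (isMorphism_subtype_val (proj n) S).1 using 1
      ext z
      change _ ↔ eval (Projectivization.rep z.1) Q' ≠ 0
      rw [h]
      exact eval_rep_mk_ne_zero hQ _ _
    refine ⟨hc, fun z f hf => ?_⟩
    obtain ⟨d, P, Q, hP, hQ, h0, h⟩ := regAt_proj.1 hf
    obtain ⟨P', hP', hPe⟩ := exists_isHomogeneous_comp_linear A hP
    obtain ⟨Q', hQ', hQe⟩ := exists_isHomogeneous_comp_linear A hQ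
    refine ⟨fun y => eval (Projectivization.rep y) P' / eval (Projectivization.rep y) Q',
      regAt_proj.2 ⟨d, P', Q', hP', hQ', ?_, Eventually.of_forall fun _ => rfl⟩, ?_⟩
    · rw [hQe]
      exact (eval_rep_mk_ne_zero hQ _ _).1 h0
    · filter_upwards [(hc.tendsto z).eventually h] with y hy
      change f (e.symm y) = _
      rw [hy, hPe, hQe]
      exact eval_rep_mk_div hP hQ _ _
  · intro v hv
    refine ⟨hT0 v hv, ?_⟩
    obtain ⟨a, ha⟩ := Projectivization.exists_smul_eq_mk_rep ℂ v hv
    refine (Projectivization.mk_eq_mk_iff ℂ _ _ _ _).2 ⟨a, ?_⟩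
    rw [← ha, T.map_smul_of_tower]

/-! ### Affine charts -/

/-- An open subset `V` of a space with functions, identified by the coordinates `t` with a subset
of affine space on which the regular functions are the quotients of polynomials.  The inverse `τ`
of the coordinates is defined in a Euclidean neighbourhood of each point of the subset. -/
structure Chart (X : FunSpace) (ι : Type) where
  t : X → ι → ℂ
  V : Set X
  τ : (ι → ℂ) → X
  regAt_iff : ∀ x ∈ V, ∀ f : X → ℂ, X.RegAt f x ↔ ∃ p q : MvPolynomial ι ℂ, eval (t x) q ≠ 0 ∧
    ∀ᶠ y in 𝓝 x, f y = eval (t y) p / eval (t y) q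
  isOpen_ne : ∀ q : MvPolynomial ι ℂ, IsOpen {x | x ∈ V ∧ eval (t x) q ≠ 0}
  τ_t : ∀ x ∈ V, τ (t x) = x
  tendsto_τ : ∀ x ∈ V, Tendsto τ (𝓝 (t x)) (𝓝 x)
  t_τ : ∀ x ∈ V, ∀ᶠ v in 𝓝 (t x), t (τ v) = v

namespace Chart

variable {X : FunSpace} {ι : Type} (c : Chart X ι) {x : X} {f g : X → ℂ}

theorem isOpen_V : IsOpen c.V := by
  simpa using c.isOpen_ne 1

theorem eventually_mem_V (hx : x ∈ c.V) : ∀ᶠ y in 𝓝 x, y ∈ c.V :=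
  c.isOpen_V.mem_nhds hx

theorem eventually_eval_ne_zero (hx : x ∈ c.V) {q : MvPolynomial ι ℂ}
    (h : eval (c.t x) q ≠ 0) : ∀ᶠ y in 𝓝 x, eval (c.t y) q ≠ 0 :=
  Filter.mem_of_superset ((c.isOpen_ne q).mem_nhds ⟨hx, h⟩) fun _ h => h.2

theorem regAt_of_eventually (hx : x ∈ c.V) (hf : X.RegAt f x) (h : ∀ᶠ y in 𝓝 x, g y = f y) :
    X.RegAt g x := by
  obtain ⟨p, q, hq, hpq⟩ := (c.regAt_iff x hx f).1 hf
  refine (c.regAt_iff x hx g).2 ⟨p, q, hq, ?_⟩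
  filter_upwards [h, hpq] with y h1 h2
  rw [h1, h2]

theorem regAt_eval_t (hx : x ∈ c.V) (p : MvPolynomial ι ℂ) :
    X.RegAt (fun y => eval (c.t y) p) x :=
  (c.regAt_iff x hx _).2 ⟨p, 1, by simp, by simp⟩

theorem regAt_const (hx : x ∈ c.V) (a : ℂ) : X.RegAt (fun _ => a) x := by
  simpa using c.regAt_eval_t hx (C a)

theorem regAt_add (hx : x ∈ c.V) (hf : X.RegAt f x) (hg : X.RegAt g x) :
    X.RegAt (fun y => f y + g y) x := by
  obtain ⟨p, q, hq, hpq⟩ := (c.regAt_iff x hx f).1 hf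
  obtain ⟨p', q', hq', hpq'⟩ := (c.regAt_iff x hx g).1 hg
  refine (c.regAt_iff x hx _).2 ⟨p * q' + q * p', q * q', by simp [hq, hq'], ?_⟩
  filter_upwards [hpq, hpq', c.eventually_eval_ne_zero hx hq, c.eventually_eval_ne_zero hx hq']
    with y h1 h2 h3 h4
  rw [h1, h2, div_add_div _ _ h3 h4]
  simp

theorem regAt_mul (hx : x ∈ c.V) (hf : X.RegAt f x) (hg : X.RegAt g x) :
    X.RegAt (fun y => f y * g y) x := by
  obtain ⟨p, q, hq, hpq⟩ := (c.regAt_iff x hx f).1 hf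
  obtain ⟨p', q', hq', hpq'⟩ := (c.regAt_iff x hx g).1 hg
  refine (c.regAt_iff x hx _).2 ⟨p * p', q * q', by simp [hq, hq'], ?_⟩
  filter_upwards [hpq, hpq'] with y h1 h2
  rw [h1, h2, div_mul_div_comm]
  simp

theorem regAt_div (hx : x ∈ c.V) (hf : X.RegAt f x) (hg : X.RegAt g x) (h : g x ≠ 0) :
    X.RegAt (fun y => f y / g y) x := by
  obtain ⟨p, q, hq, hpq⟩ := (c.regAt_iff x hx f).1 hf
  obtain ⟨p', q', hq', hpq'⟩ := (c.regAt_iff x hx g).1 hg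
  have hp' : eval (c.t x) p' ≠ 0 := by
    rw [hpq'.self_of_nhds] at h
    exact fun h' => h (by simp [h'])
  refine (c.regAt_iff x hx _).2 ⟨p * q', q * p', by simp [hq, hp'], ?_⟩
  filter_upwards [hpq, hpq'] with y h1 h2
  rw [h1, h2, div_div_div_eq]
  simp

theorem regAt_eval (hx : x ∈ c.V) {κ : Type} {f : κ → X → ℂ} (hf : ∀ k, X.RegAt (f k) x)
    (P : MvPolynomial κ ℂ) : X.RegAt (fun y => eval (fun k => f k y) P) x := by
  induction P using MvPolynomial.induction_on with
  | C a => simpa using c.regAt_const hx a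
  | add p q hp hq => simpa using c.regAt_add hx hp hq
  | mul_X p i hp => simpa using c.regAt_mul hx hp (hf i)

theorem eventually_regAt (hx : x ∈ c.V) (hf : X.RegAt f x) : ∀ᶠ y in 𝓝 x, X.RegAt f y := by
  obtain ⟨p, q, hq, hpq⟩ := (c.regAt_iff x hx f).1 hf
  filter_upwards [hpq.eventually_nhds, c.eventually_eval_ne_zero hx hq, c.eventually_mem_V hx]
    with y h1 h2 h3
  exact (c.regAt_iff y h3 f).2 ⟨p, q, h2, h1⟩

theorem eventually_ne_zero (hx : x ∈ c.V) (hf : X.RegAt f x) (h : f x ≠ 0) :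
    ∀ᶠ y in 𝓝 x, f y ≠ 0 := by
  obtain ⟨p, q, hq, hpq⟩ := (c.regAt_iff x hx f).1 hf
  have hp : eval (c.t x) p ≠ 0 := by
    rw [hpq.self_of_nhds] at h
    exact fun h' => h (by simp [h'])
  filter_upwards [hpq, c.eventually_eval_ne_zero hx hq, c.eventually_eval_ne_zero hx hp]
    with y h1 h2 h3
  rw [h1]
  exact div_ne_zero h3 h2

end Chart

/-! ### Points of blow-ups -/

namespace BlowUpPoint

variable {X : FunSpace} {Y : Set X}

theorem ext_of_smul {ξ η : BlowUpPoint X Y} (hb : ξ.base = η.base) (a : ℂ)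
    (h : ∀ f, ξ.dir.rep f = a * η.dir.rep f) : ξ = η := by
  have hd : ξ.dir = η.dir := by
    rw [← Projectivization.mk_rep ξ.dir, ← Projectivization.mk_rep η.dir]
    exact (Projectivization.mk_eq_mk_iff' ℂ _ _ _ _).2 ⟨a, funext fun f => (h f).symm⟩
  cases ξ
  cases η
  cases hb
  cases hd
  rfl

/-- The point of the blow-up given by a functional on the stalk of the ideal. -/
def ofFunctional (x : X) (l : (X → ℂ) → ℂ) (hl : l ≠ 0)
    (support : ∀ f, f ∉ X.idealAt Y x → l f = 0)
    (semilinear : ∀ (c f g : X → ℂ), X.RegAt c x → f ∈ X.idealAt Y x →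
      g ∈ X.idealAt Y x → (∀ᶠ y in 𝓝 x, g y = c y * f y) → l g = c x * l f)
    (relation : ∀ (n d : ℕ) (f : Fin n → X → ℂ) (P : MvPolynomial (Fin n) ℂ),
      (∀ i, f i ∈ X.idealAt Y x) → P.IsHomogeneous d →
      (∀ᶠ y in 𝓝 x, eval (fun i => f i y) P = 0) → eval (fun i => l (f i)) P = 0) :
    BlowUpPoint X Y where
  base := x
  dir := Projectivization.mk ℂ l hl
  support f hf := by
    obtain ⟨a, -, h⟩ := rep_mk_eq_mul l hl
    rw [h, support f hf, mul_zero]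
  semilinear c f g hc hf hg hfg := by
    obtain ⟨a, -, h⟩ := rep_mk_eq_mul l hl
    rw [h, h, semilinear c f g hc hf hg hfg]
    ring
  relation n d f P hf hP hfP := by
    obtain ⟨a, -, h⟩ := rep_mk_eq_mul l hl
    simp only [h]
    rw [eval_smul_of_isHomogeneous hP a (fun i => l (f i)), relation n d f P hf hP hfP, mul_zero]

/-- The representative is a non-zero functional, and `support` makes it vanish off the ideal. -/
theorem exists_mem_idealAt_rep_ne_zero (ξ : BlowUpPoint X Y) :
    ∃ f ∈ X.idealAt Y ξ.base, ξ.dir.rep f ≠ 0 := by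
  by_contra! h
  refine Projectivization.rep_nonzero ξ.dir (funext fun f => ?_)
  by_cases hf : f ∈ X.idealAt Y ξ.base
  · exact h f hf
  · exact ξ.support f hf

theorem value_smul {ξ : BlowUpPoint X Y} {n d : ℕ} {f : Fin n → X → ℂ}
    {P : MvPolynomial (Fin n) ℂ} (hP : P.IsHomogeneous d) {a : ℂ} {l : Fin n → ℂ}
    (h : ∀ i, ξ.dir.rep (f i) = a * l i) : ξ.value f P = a ^ d * eval l P := by
  rw [value, funext h, eval_smul_of_isHomogeneous hP]

end BlowUpPoint

theorem isOpen_blowUpBasicOpen {X : FunSpace} {Y U : Set X} (hU : IsOpen U) {n d : ℕ}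
    {f : Fin n → X → ℂ} {P : MvPolynomial (Fin n) ℂ} (hf : ∀ y ∈ U, ∀ i, f i ∈ X.idealAt Y y)
    (hP : P.IsHomogeneous d) :
    IsOpen (X := X.blowUp Y) (blowUpBasicOpen (Y := Y) U f P) :=
  TopologicalSpace.isOpen_generateFrom_of_mem ⟨U, n, d, f, P, hU, hf, hP, rfl⟩

theorem continuous_blowDown (X : FunSpace) (Y : Set X) : Continuous (X.blowDown Y) := by
  refine ⟨fun U hU => ?_⟩
  -- The preimage of `U` is the basic open set of the constant 1, a polynomial in no elements of the
  -- ideal.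
  have h : X.blowDown Y ⁻¹' U = blowUpBasicOpen (Y := Y) U Fin.elim0 (1 : MvPolynomial (Fin 0) ℂ) := by
    ext ξ
    simp [blowUpBasicOpen, BlowUpPoint.value, FunSpace.blowDown]
    rfl
  rw [h]
  exact isOpen_blowUpBasicOpen hU (fun _ _ i => i.elim0) (isHomogeneous_one (Fin 0) ℂ)

/-- Convergence need only be tested on the generating open sets, each of which is a condition on the
base point and the non-vanishing of one element of the Rees algebra. -/
theorem tendsto_blowUp {X : FunSpace} {Y : Set X} {α : Type} {l : Filter α}
    {g : α → X.blowUp Y} {ξ : X.blowUp Y}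
    (hb : Tendsto (fun a => X.blowDown Y (g a)) l (𝓝 (X.blowDown Y ξ)))
    (h : ∀ (n d : ℕ) (f : Fin n → X → ℂ) (P : MvPolynomial (Fin n) ℂ), P.IsHomogeneous d →
      (∀ᶠ y in 𝓝 (X.blowDown Y ξ), ∀ i, f i ∈ X.idealAt Y y) → BlowUpPoint.value ξ f P ≠ 0 →
      ∀ᶠ a in l, BlowUpPoint.value (g a) f P ≠ 0) : Tendsto g l (𝓝 ξ) := by
  refine TopologicalSpace.tendsto_nhds_generateFrom_iff.2 ?_
  rintro _ ⟨U, n, d, f, P, hU, hf, hP, rfl⟩ ⟨h1, h2⟩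
  filter_upwards [hb.eventually (hU.mem_nhds h1),
    h n d f P hP (Filter.mem_of_superset (hU.mem_nhds h1) hf) h2] with a h3 h4
  exact ⟨h3, h4⟩

/-! ### The blow-up away from its centre -/

namespace Chart

variable {X : FunSpace} {ι : Type} (c : Chart X ι) {Y : Set X} {x : X}

/-- Off the centre the ideal contains 1, and semilinearity applied to f = f · 1 leaves only the
multiples of evaluation at the base point. -/
theorem rep_eq_of_eventually_notMem (ξ : BlowUpPoint X Y) (hx : ξ.base ∈ c.V)
    (hY : ∀ᶠ y in 𝓝 ξ.base, y ∉ Y) :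
    ∃ a : ℂ, a ≠ 0 ∧ ∀ f, X.RegAt f ξ.base → ξ.dir.rep f = a * f ξ.base := by
  have hmem : ∀ f, X.RegAt f ξ.base → f ∈ X.idealAt Y ξ.base := fun f hf =>
    ⟨hf, hY.mono fun y h1 h2 => absurd h2 h1⟩
  have h : ∀ f, X.RegAt f ξ.base → ξ.dir.rep f = ξ.dir.rep (fun _ => 1) * f ξ.base := by
    intro f hf
    rw [ξ.semilinear f (fun _ => 1) f hf (hmem _ (c.regAt_const hx 1)) (hmem f hf) (by simp),
      mul_comm]
  refine ⟨_, ?_, h⟩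
  obtain ⟨f, hf, h0⟩ := ξ.exists_mem_idealAt_rep_ne_zero
  rw [h f hf.1] at h0
  exact left_ne_zero_of_mul h0

open Classical in
/-- The point of the blow-up over a point off the centre. -/
def unitPoint (hx : x ∈ c.V) (hY : ∀ᶠ y in 𝓝 x, y ∉ Y) : BlowUpPoint X Y :=
  BlowUpPoint.ofFunctional x (fun f => if X.RegAt f x then f x else 0)
    (fun h => by simpa [c.regAt_const hx 1] using congrFun h (fun _ => 1))
    (fun f hf => if_neg fun h => hf ⟨h, hY.mono fun y h1 h2 => absurd h2 h1⟩)
    (fun a f g _ hf hg h => by simp [hf.1, hg.1, h.self_of_nhds])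
    (fun n d f P hf _ h => by simpa [(hf _).1] using h.self_of_nhds)

theorem eq_of_base_eq {ξ η : BlowUpPoint X Y} (h : ξ.base = η.base) (hx : η.base ∈ c.V)
    (hY : ∀ᶠ y in 𝓝 η.base, y ∉ Y) : ξ = η := by
  obtain ⟨a, ha, h1⟩ := c.rep_eq_of_eventually_notMem ξ (h ▸ hx) (h ▸ hY)
  obtain ⟨b, hb, h2⟩ := c.rep_eq_of_eventually_notMem η hx hY
  refine BlowUpPoint.ext_of_smul h (a / b) fun f => ?_
  by_cases hf : X.RegAt f η.base
  · rw [h1 f (h ▸ hf), h2 f hf, h]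
    field_simp
  · rw [ξ.support f (fun h' => hf (h ▸ h'.1)), η.support f (fun h' => hf h'.1), mul_zero]

open Classical in
/-- The inverse of the structure morphism of the blow-up, off the centre. -/
def section_ (hV : ∀ y ∈ c.V, y ∉ Y) (hx : x ∈ c.V) (y : X) : BlowUpPoint X Y :=
  if hy : y ∈ c.V then c.unitPoint hy ((c.eventually_mem_V hy).mono hV)
  -- A default value outside the chart, where the section is never used.
  else c.unitPoint hx ((c.eventually_mem_V hx).mono hV)

variable (hV : ∀ y ∈ c.V, y ∉ Y) (hx : x ∈ c.V)

theorem blowDown_section {y : X} (hy : y ∈ c.V) : X.blowDown Y (c.section_ hV hx y) = y := by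
  rw [section_, dif_pos hy]
  rfl

/-- Off the centre a homogeneous element P(f₁, …, fₙ) of the Rees algebra takes, up to a non-zero
scalar, the value of the regular function P(f₁, …, fₙ) at the base point, so its non-vanishing is an
open condition there. -/
theorem tendsto_section {ξ : X.blowUp Y} (hξ : X.blowDown Y ξ ∈ c.V) :
    Tendsto (β := X.blowUp Y) (c.section_ hV hx) (𝓝 (X.blowDown Y ξ)) (𝓝 ξ) := by
  refine tendsto_blowUp ?_ ?_
  · refine tendsto_id.congr' ?_
    filter_upwards [c.eventually_mem_V hξ] with y hy
    rw [c.blowDown_section hV hx hy, id]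
  · intro n d f P hP hf h0
    obtain ⟨a, ha, h⟩ := c.rep_eq_of_eventually_notMem ξ hξ ((c.eventually_mem_V hξ).mono hV)
    have hreg : ∀ i, X.RegAt (f i) (X.blowDown Y ξ) := fun i => (hf.self_of_nhds i).1
    rw [BlowUpPoint.value_smul hP (fun i => h (f i) (hreg i))] at h0
    filter_upwards [c.eventually_ne_zero hξ (c.regAt_eval hξ hreg P) (right_ne_zero_of_mul h0),
      hf, c.eventually_mem_V hξ] with y h1 h2 h3
    have hb := c.blowDown_section hV hx h3
    have h3' : (c.section_ hV hx y).base ∈ c.V := by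
      change X.blowDown Y _ ∈ _
      rwa [hb]
    obtain ⟨b, hb0, h4⟩ := c.rep_eq_of_eventually_notMem (c.section_ hV hx y) h3'
      ((c.eventually_mem_V h3').mono hV)
    change BlowUpPoint.base _ = y at hb
    rw [hb] at h4
    rw [BlowUpPoint.value_smul hP (fun i => h4 (f i) (h2 i).1)]
    exact mul_ne_zero (pow_ne_zero _ hb0) h1

/-- In a quotient of two elements of equal degree the unknown scalars cancel, which leaves a regular
function of the base point. Conversely, numerator and denominator of a quotient of polynomials both
lie in the unit ideal, so the quotient is one of degree one. -/
theorem regAt_blowUp_of_notMem_centre (hV : ∀ y ∈ c.V, y ∉ Y) {ξ : X.blowUp Y} (hξ : X.blowDown Y ξ ∈ c.V)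
    (F : X.blowUp Y → ℂ) :
    (X.blowUp Y).RegAt F ξ ↔ ∃ p q : MvPolynomial ι ℂ, eval (c.t (X.blowDown Y ξ)) q ≠ 0 ∧
      ∀ᶠ η in 𝓝 ξ, F η = eval (c.t (X.blowDown Y η)) p / eval (c.t (X.blowDown Y η)) q := by
  have hb := (continuous_blowDown X Y).tendsto ξ
  have hVξ := hb.eventually (c.eventually_mem_V hξ)
  constructor
  · rintro ⟨n, d, f, P, Q, hf, hP, hQ, h0, hF⟩
    have hreg : ∀ i, X.RegAt (f i) (X.blowDown Y ξ) := fun i => (hf i).1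
    obtain ⟨a, ha, h⟩ := c.rep_eq_of_eventually_notMem ξ hξ ((c.eventually_mem_V hξ).mono hV)
    rw [BlowUpPoint.value_smul hQ (fun i => h (f i) (hreg i))] at h0
    obtain ⟨p, q, hq, hpq⟩ := (c.regAt_iff _ hξ _).1 (c.regAt_div hξ (c.regAt_eval hξ hreg P)
      (c.regAt_eval hξ hreg Q) (right_ne_zero_of_mul h0))
    refine ⟨p, q, hq, ?_⟩
    have hreg' : ∀ᶠ y in 𝓝 (X.blowDown Y ξ), ∀ i, X.RegAt (f i) y :=
      eventually_all.2 fun i => c.eventually_regAt hξ (hreg i)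
    filter_upwards [hF, hb.eventually hpq, hVξ, hb.eventually hreg'] with η h1 h2 h3 h4
    obtain ⟨b, hb0, h5⟩ := c.rep_eq_of_eventually_notMem η h3 ((c.eventually_mem_V h3).mono hV)
    rw [h1, ← h2, BlowUpPoint.value_smul hP (fun i => h5 (f i) (h4 i)),
      BlowUpPoint.value_smul hQ (fun i => h5 (f i) (h4 i)), mul_div_mul_left _ _ (pow_ne_zero _ hb0)]
    rfl
  · rintro ⟨p, q, hq, hpq⟩
    have hreg : ∀ y ∈ c.V, ∀ i : Fin 2,
        X.RegAt ((![fun y => eval (c.t y) p, fun y => eval (c.t y) q] : Fin 2 → X → ℂ) i) y := by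
      intro y hy i
      fin_cases i
      exacts [c.regAt_eval_t hy p, c.regAt_eval_t hy q]
    refine ⟨2, 1, ![fun y => eval (c.t y) p, fun y => eval (c.t y) q], MvPolynomial.X 0, MvPolynomial.X 1,
      fun i => ⟨hreg _ hξ i, (c.eventually_mem_V hξ).mono fun y h1 h2 => absurd h2 (hV y h1)⟩,
      isHomogeneous_X ℂ 0, isHomogeneous_X ℂ 1, ?_, ?_⟩
    · obtain ⟨b, hb0, h5⟩ := c.rep_eq_of_eventually_notMem ξ hξ ((c.eventually_mem_V hξ).mono hV)
      rw [BlowUpPoint.value_smul (isHomogeneous_X ℂ 1) (fun i => h5 _ (hreg _ hξ i))]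
      have hq' : eval (c.t ξ.base) q ≠ 0 := hq
      simpa [hb0] using hq'
    · filter_upwards [hpq, hVξ] with η h1 h2
      obtain ⟨b, hb0, h5⟩ := c.rep_eq_of_eventually_notMem η h2 ((c.eventually_mem_V h2).mono hV)
      rw [BlowUpPoint.value_smul (isHomogeneous_X ℂ 0) (fun i => h5 _ (hreg _ h2 i)),
        BlowUpPoint.value_smul (isHomogeneous_X ℂ 1) (fun i => h5 _ (hreg _ h2 i)), h1,
        mul_div_mul_left _ _ (pow_ne_zero _ hb0)]
      simp [FunSpace.blowDown]

/-- A chart that does not meet the centre is a chart of the blow-up. -/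
def blowUp : Chart (X.blowUp Y) ι where
  t ξ := c.t (X.blowDown Y ξ)
  V := X.blowDown Y ⁻¹' c.V
  τ v := c.section_ hV hx (c.τ v)
  regAt_iff _ hξ F := c.regAt_blowUp_of_notMem_centre hV hξ F
  isOpen_ne q := (c.isOpen_ne q).preimage (continuous_blowDown X Y)
  τ_t ξ hξ := by
    rw [c.τ_t _ hξ]
    refine c.eq_of_base_eq (c.blowDown_section hV hx hξ) hξ ((c.eventually_mem_V hξ).mono hV)
  tendsto_τ ξ hξ := (c.tendsto_section hV hx hξ).comp (c.tendsto_τ _ hξ)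
  t_τ ξ hξ := by
    filter_upwards [c.t_τ _ hξ, (c.tendsto_τ _ hξ).eventually (c.eventually_mem_V hξ)] with v h1 h2
    rw [c.blowDown_section hV hx h2, h1]

end Chart

/-! ### Degree-one elements of the Rees algebra -/

namespace BlowUpPoint

variable {X : FunSpace} {Y : Set X}

/-- Additivity is not required in `BlowUpPoint`; it is the case of the linear relation X₀ - X₁ - X₂.
-/
theorem rep_add (ξ : BlowUpPoint X Y) {f g h : X → ℂ} (hf : f ∈ X.idealAt Y ξ.base)
    (hg : g ∈ X.idealAt Y ξ.base) (hh : h ∈ X.idealAt Y ξ.base)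
    (hfg : ∀ᶠ y in 𝓝 ξ.base, h y = f y + g y) :
    ξ.dir.rep h = ξ.dir.rep f + ξ.dir.rep g := by
  have := ξ.relation 3 1 ![h, f, g] (MvPolynomial.X 0 - MvPolynomial.X 1 - MvPolynomial.X 2)
    (by intro i; fin_cases i <;> assumption)
    (((isHomogeneous_X ℂ 0).sub (isHomogeneous_X ℂ 1)).sub (isHomogeneous_X ℂ 2))
    (by filter_upwards [hfg] with y hy; simp [hy])
  simp only [map_sub, eval_X, Matrix.cons_val] at this
  linear_combination this

end BlowUpPoint

/-- Elements of the Rees algebra of degree one define a morphism to a projective space. -/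
theorem isMorphism_mk_rep {X : FunSpace} {Y : Set X} {n : ℕ} {g : Fin n → X → ℂ} {U : Set X}
    (hU : IsOpen U) (hg : ∀ y ∈ U, ∀ k, g k ∈ X.idealAt Y y) {W : Set (X.blowUp Y)}
    (hW : ∀ ξ ∈ W, X.blowDown Y ξ ∈ U) {φ : (X.blowUp Y).sub W → proj n}
    (hφ : ∀ ξ, ∃ h, φ ξ = Projectivization.mk ℂ
      (fun k => (BlowUpPoint.dir ξ.1).rep (g k) : Fin n → ℂ) h) :
    IsMorphism ((X.blowUp Y).sub W) (proj n) φ := by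
  have hc : Continuous φ := by
    refine continuous_proj fun d Q hQ => ?_
    convert (isOpen_blowUpBasicOpen hU hg hQ).preimage
      (isMorphism_subtype_val (X.blowUp Y) W).1 using 1
    ext ξ
    obtain ⟨h, hξ⟩ := hφ ξ
    change eval (Projectivization.rep (φ ξ)) Q ≠ 0 ↔ _
    rw [hξ, eval_rep_mk_ne_zero hQ]
    exact ⟨fun h => ⟨hW _ ξ.2, h⟩, fun h => h.2⟩
  refine ⟨hc, fun ξ f hf => ?_⟩
  obtain ⟨d, P, Q, hP, hQ, h0, h⟩ := regAt_proj.1 hf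
  refine ⟨fun η => BlowUpPoint.value η g P / BlowUpPoint.value η g Q,
    ⟨n, d, g, P, Q, hg _ (hW _ ξ.2), hP, hQ, ?_, Eventually.of_forall fun _ => rfl⟩, ?_⟩
  · obtain ⟨h', hξ⟩ := hφ ξ
    rw [hξ, eval_rep_mk_ne_zero hQ] at h0
    exact h0
  · filter_upwards [(hc.tendsto ξ).eventually h] with η hη
    obtain ⟨h', hξ⟩ := hφ η
    change f (φ η) = _
    rw [hη, hξ, eval_rep_mk_div hP hQ]
    rfl

/-! ### Polynomials vanishing on a diagonal -/

section Diagonal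

variable {ι : Type} [DecidableEq ι] (i j k : ι)

/-- The retraction of the index set that sends `j` and `k` to `i`. -/
def collapse (l : ι) : ι := if l = j ∨ l = k then i else l

/-- Modulo X_j - X_i and X_k - X_i every variable equals its image under `collapse`; the induction
carries this over to polynomials. -/
theorem exists_eq_rename_collapse_add (p : MvPolynomial ι ℂ) :
    ∃ a b, p = rename (collapse i j k) p + a * (X j - X i) + b * (X k - X i) := by
  induction p using MvPolynomial.induction_on with
  | C c => exact ⟨0, 0, by simp⟩
  | add p q hp hq =>
    obtain ⟨a, b, h⟩ := hp
    obtain ⟨a', b', h'⟩ := hq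
    refine ⟨a + a', b + b', ?_⟩
    rw [map_add]
    linear_combination h + h'
  | mul_X p l hp =>
    obtain ⟨a, b, h⟩ := hp
    rw [map_mul, rename_X]
    by_cases hj : l = j
    · refine ⟨a * X l + rename (collapse i j k) p, b * X l, ?_⟩
      rw [collapse, if_pos (Or.inl hj)]
      subst hj
      linear_combination X l * h
    · by_cases hk : l = k
      · refine ⟨a * X l, b * X l + rename (collapse i j k) p, ?_⟩
        rw [collapse, if_pos (Or.inr hk)]
        subst hk
        linear_combination X l * h
      · refine ⟨a * X l, b * X l, ?_⟩
        rw [collapse, if_neg (by tauto)]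
        linear_combination X l * h

omit [DecidableEq ι] in
-- A ball for the sup norm is a product of infinite sets, and a polynomial that vanishes on such a
-- product is zero.
theorem eq_zero_of_eventually_eval_eq_zero [Finite ι] {p : MvPolynomial ι ℂ} {v₀ : ι → ℂ}
    (h : ∀ᶠ v in 𝓝 v₀, eval v p = 0) : p = 0 := by
  have := Fintype.ofFinite ι
  obtain ⟨ε, hε, hb⟩ := Metric.eventually_nhds_iff_ball.1 h
  refine funext_set (fun i => Metric.ball (v₀ i) ε)
    (fun i => infinite_of_mem_nhds (v₀ i) (Metric.ball_mem_nhds _ hε)) fun v hv => ?_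
  rw [map_zero]
  refine hb v ?_
  rw [ball_pi _ hε]
  exact hv

end Diagonal

/-! ### Blowing up a diagonal in a chart -/

namespace Chart

variable {X : FunSpace} {ι : Type} (c : Chart X ι) {i j k : ι} {Y : Set X} {x : X}

/-- In the chart, `Y` is the diagonal of the coordinates `i`, `j`, `k`. -/
structure IsDiagonal (c : Chart X ι) (Y : Set X) (i j k : ι) : Prop where
  ij : i ≠ j
  ik : i ≠ k
  jk : j ≠ k
  mem_iff : ∀ x ∈ c.V, x ∈ Y ↔ c.t x j = c.t x i ∧ c.t x k = c.t x i

/-- The bridge from the Zariski to the Euclidean topology: near `x` a regular function is a quotient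
of polynomials in the coordinates, hence continuous in them. -/
theorem tendsto_regAt (hx : x ∈ c.V) {f : X → ℂ} (hf : X.RegAt f x) :
    Tendsto (fun v => f (c.τ v)) (𝓝 (c.t x)) (𝓝 (f x)) := by
  obtain ⟨p, q, hq, hpq⟩ := (c.regAt_iff x hx f).1 hf
  rw [hpq.self_of_nhds]
  have h : ∀ p : MvPolynomial ι ℂ, Tendsto (fun v => eval v p) (𝓝 (c.t x)) (𝓝 (eval (c.t x) p)) :=
    fun p => (MvPolynomial.continuous_eval p).tendsto _
  refine ((h p).div (h q) hq).congr' ?_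
  filter_upwards [c.t_τ x hx, (c.tendsto_τ x hx).eventually hpq] with v h1 h2
  rw [h2, h1]
  rfl

/-- The difference of two coordinates. -/
def diff (i j : ι) (y : X) : ℂ := c.t y j - c.t y i

variable {c}

theorem eventually_notMem (hY : IsDiagonal c Y i j k) (hx : x ∈ c.V) (hxY : x ∉ Y) :
    ∀ᶠ y in 𝓝 x, y ∉ Y := by
  rw [hY.mem_iff x hx, not_and_or] at hxY
  rcases hxY with h | h
  · filter_upwards [c.eventually_mem_V hx, c.eventually_eval_ne_zero hx
      (q := MvPolynomial.X j - MvPolynomial.X i) (by simpa [sub_eq_zero] using h)] with y h1 h2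
    rw [hY.mem_iff y h1]
    simp only [map_sub, eval_X, ne_eq, sub_eq_zero] at h2
    tauto
  · filter_upwards [c.eventually_mem_V hx, c.eventually_eval_ne_zero hx
      (q := MvPolynomial.X k - MvPolynomial.X i) (by simpa [sub_eq_zero] using h)] with y h1 h2
    rw [hY.mem_iff y h1]
    simp only [map_sub, eval_X, ne_eq, sub_eq_zero] at h2
    tauto

theorem mul_diff_add_mem_idealAt (hY : IsDiagonal c Y i j k) (hx : x ∈ c.V) {a b : X → ℂ}
    (ha : X.RegAt a x) (hb : X.RegAt b x) :
    (fun y => a y * c.diff i j y + b y * c.diff i k y) ∈ X.idealAt Y x := by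
  have h : ∀ l, X.RegAt (c.diff i l) x := fun l => by
    exact c.regAt_of_eventually hx (c.regAt_eval_t hx (MvPolynomial.X l - MvPolynomial.X i))
      (by simp [diff])
  refine ⟨c.regAt_add hx (c.regAt_mul hx ha (h j)) (c.regAt_mul hx hb (h k)), ?_⟩
  filter_upwards [c.eventually_mem_V hx] with y hy hyY
  obtain ⟨h1, h2⟩ := (hY.mem_iff y hy).1 hyY
  simp [diff, h1, h2]

theorem diff_mem_idealAt (hY : IsDiagonal c Y i j k) (hx : x ∈ c.V) :
    c.diff i j ∈ X.idealAt Y x ∧ c.diff i k ∈ X.idealAt Y x := by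
  have h0 := c.regAt_const hx 0
  have h1 := c.regAt_const hx 1
  exact ⟨by simpa using mul_diff_add_mem_idealAt hY hx h1 h0,
    by simpa using mul_diff_add_mem_idealAt hY hx h0 h1⟩

/-- The ideal of the diagonal is generated by two differences of coordinates. -/
theorem exists_eq_mul_diff_add [Finite ι] (hY : IsDiagonal c Y i j k) (hx : x ∈ c.V) (hxY : x ∈ Y)
    {f : X → ℂ} (hf : f ∈ X.idealAt Y x) : ∃ a b : X → ℂ, X.RegAt a x ∧ X.RegAt b x ∧
      ∀ᶠ y in 𝓝 x, f y = a y * c.diff i j y + b y * c.diff i k y := by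
  classical
  obtain ⟨p, q, hq, hpq⟩ := (c.regAt_iff x hx f).1 hf.1
  obtain ⟨a, b, hab⟩ := exists_eq_rename_collapse_add i j k p
  obtain ⟨hxj, hxk⟩ := (hY.mem_iff x hx).1 hxY
  have hcol : ∀ v : ι → ℂ, v j = v i → v k = v i → v ∘ collapse i j k = v := by
    intro v h1 h2
    funext l
    by_cases hl : l = j ∨ l = k
    · rcases hl with rfl | rfl <;> simp [collapse, h1, h2]
    · simp [collapse, hl]
  -- The restriction of the numerator to the diagonal is zero: for `v` near `c.t x` the point `v ∘
  -- collapse i j k` of the diagonal is again near `c.t x`, so `τ` sends it to a point of `Y`, where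
  -- `f` vanishes and the denominator does not.
  have h0 : rename (collapse i j k) p = 0 := by
    refine eq_zero_of_eventually_eval_eq_zero (v₀ := c.t x) ?_
    have hcont : Tendsto (fun v : ι → ℂ => v ∘ collapse i j k) (𝓝 (c.t x)) (𝓝 (c.t x)) := by
      have h : Continuous fun v : ι → ℂ => v ∘ collapse i j k :=
        continuous_pi fun l => continuous_apply _
      simpa [hcol _ hxj hxk] using h.tendsto (c.t x)
    have h1 : ∀ᶠ v in 𝓝 (c.t x), eval v q ≠ 0 ∧ t c (τ c v) = v ∧ τ c v ∈ c.V ∧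
        (τ c v ∈ Y → f (τ c v) = 0) ∧ f (τ c v) =
          eval (c.t (τ c v)) p / eval (c.t (τ c v)) q := by
      filter_upwards [((MvPolynomial.continuous_eval q).tendsto _).eventually_ne hq, c.t_τ x hx,
        (c.tendsto_τ x hx).eventually (c.eventually_mem_V hx),
        (c.tendsto_τ x hx).eventually hf.2, (c.tendsto_τ x hx).eventually hpq]
        with v h1 h2 h3 h4 h5
      exact ⟨h1, h2, h3, h4, h5⟩
    filter_upwards [hcont.eventually h1] with v ⟨h1, h2, h3, h4, h5⟩
    rw [eval_rename]
    have h6 : τ c (v ∘ collapse i j k) ∈ Y := by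
      rw [hY.mem_iff _ h3, h2]
      have := hY.ij
      have := hY.ik
      simp [collapse, *]
    rw [h4 h6, h2] at h5
    exact (div_eq_zero_iff.1 h5.symm).resolve_right h1
  rw [h0, zero_add] at hab
  have hreg : ∀ r : MvPolynomial ι ℂ, X.RegAt (fun y => eval (c.t y) r / eval (c.t y) q) x :=
    fun r => (c.regAt_iff x hx _).2 ⟨r, q, hq, Eventually.of_forall fun _ => rfl⟩
  refine ⟨_, _, hreg a, hreg b, ?_⟩
  filter_upwards [hpq] with y hy
  rw [hy, hab]
  simp only [map_add, map_mul, map_sub, eval_X, diff]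
  ring

/-- The functional is linear over the local ring, so its values on the two generators determine it.
-/
theorem rep_eq_of_eq_mul_diff_add (hY : IsDiagonal c Y i j k) (ξ : BlowUpPoint X Y)
    (hx : ξ.base ∈ c.V) {f a b : X → ℂ} (hf : f ∈ X.idealAt Y ξ.base) (ha : X.RegAt a ξ.base)
    (hb : X.RegAt b ξ.base)
    (h : ∀ᶠ y in 𝓝 ξ.base, f y = a y * c.diff i j y + b y * c.diff i k y) :
    ξ.dir.rep f = a ξ.base * ξ.dir.rep (c.diff i j) + b ξ.base * ξ.dir.rep (c.diff i k) := by
  obtain ⟨hu, hv⟩ := diff_mem_idealAt hY hx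
  have h0 := c.regAt_const hx 0
  have hau : (fun y => a y * c.diff i j y) ∈ X.idealAt Y ξ.base := by
    simpa using mul_diff_add_mem_idealAt hY hx ha h0
  have hbv : (fun y => b y * c.diff i k y) ∈ X.idealAt Y ξ.base := by
    simpa using mul_diff_add_mem_idealAt hY hx h0 hb
  rw [ξ.rep_add hau hbv hf h, ξ.semilinear a _ _ ha hu hau (by simp),
    ξ.semilinear b _ _ hb hv hbv (by simp)]

variable (c) in
/-- A curve in the chart that leaves the diagonal in a given direction. -/
def curve [DecidableEq ι] (j k : ι) (x : X) (s r ε : ℂ) : ι → ℂ :=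
  c.t x + Pi.single j (ε * (s + ε)) + Pi.single k (ε * (r + 2 * ε))

variable [DecidableEq ι] (s r : ℂ)

theorem tendsto_curve (j k : ι) : Tendsto (c.curve j k x s r) (𝓝 0) (𝓝 (c.t x)) := by
  have h : Continuous (c.curve j k x s r) := by
    refine continuous_pi fun l => ?_
    simp only [curve, Pi.add_apply, Pi.single_apply]
    refine (continuous_const.add ?_).add ?_ <;> split_ifs <;> fun_prop
  have h0 : c.curve j k x s r 0 = c.t x := by simp [curve]
  simpa [h0] using h.tendsto 0

theorem tendsto_τ_curve (j k : ι) (hx : x ∈ c.V) :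
    Tendsto (fun ε => c.τ (c.curve j k x s r ε)) (𝓝[≠] 0) (𝓝 x) :=
  (c.tendsto_τ x hx).comp ((tendsto_curve s r j k).mono_left nhdsWithin_le_nhds)

theorem eventually_t_τ_curve (j k : ι) (hx : x ∈ c.V) :
    ∀ᶠ ε in 𝓝[≠] 0, c.τ (c.curve j k x s r ε) ∈ c.V ∧
      c.t (c.τ (c.curve j k x s r ε)) = c.curve j k x s r ε := by
  filter_upwards [(tendsto_τ_curve s r j k hx).eventually (c.eventually_mem_V hx),
    ((tendsto_curve s r j k).mono_left nhdsWithin_le_nhds).eventually (c.t_τ x hx)] with ε h1 h2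
  exact ⟨h1, h2⟩

/-- To first order the curve has direction (s, r). The second-order terms ε² and 2ε² are non-zero
and distinct, so for small ε ≠ 0 the coordinates i, j, k are pairwise distinct even if s = 0, r = 0
or s = r. -/
theorem curve_sub (hY : IsDiagonal c Y i j k) (hx : x ∈ c.V) (hxY : x ∈ Y) (ε : ℂ) :
    c.curve j k x s r ε j - c.curve j k x s r ε i = ε * (s + ε) ∧
    c.curve j k x s r ε k - c.curve j k x s r ε i = ε * (r + 2 * ε) := by
  obtain ⟨h1, h2⟩ := (hY.mem_iff x hx).1 hxY
  have := hY.ij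
  have := hY.ik
  have := hY.jk
  have := hY.jk.symm
  constructor <;> simp [curve, *]

/-- Dividing the generators by ε along the curve leaves s + ε and r + 2ε, while the coefficients
tend to their values at `x`. -/
theorem tendsto_div_curve [Finite ι] (hY : IsDiagonal c Y i j k) (hx : x ∈ c.V) (hxY : x ∈ Y)
    {f a b : X → ℂ} (ha : X.RegAt a x)
    (hb : X.RegAt b x) (h : ∀ᶠ y in 𝓝 x, f y = a y * c.diff i j y + b y * c.diff i k y) :
    Tendsto (fun ε => f (c.τ (c.curve j k x s r ε)) / ε) (𝓝[≠] 0) (𝓝 (a x * s + b x * r)) := by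
  have hlim : ∀ {a : X → ℂ}, X.RegAt a x →
      Tendsto (fun ε => a (c.τ (c.curve j k x s r ε))) (𝓝[≠] 0) (𝓝 (a x)) := fun ha =>
    (c.tendsto_regAt hx ha).comp ((tendsto_curve s r j k).mono_left nhdsWithin_le_nhds)
  have h1 : Tendsto (fun ε : ℂ => s + ε) (𝓝[≠] 0) (𝓝 s) := by
    have : Continuous fun ε : ℂ => s + ε := by fun_prop
    simpa using (this.tendsto 0).mono_left nhdsWithin_le_nhds
  have h2 : Tendsto (fun ε : ℂ => r + 2 * ε) (𝓝[≠] 0) (𝓝 r) := by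
    have : Continuous fun ε : ℂ => r + 2 * ε := by fun_prop
    simpa using (this.tendsto 0).mono_left nhdsWithin_le_nhds
  refine (((hlim ha).mul h1).add ((hlim hb).mul h2)).congr' ?_
  filter_upwards [(tendsto_τ_curve s r j k hx).eventually h, eventually_t_τ_curve s r j k hx,
    self_mem_nhdsWithin] with ε h3 h4 h5
  have h5 : ε ≠ 0 := h5
  obtain ⟨h6, h7⟩ := curve_sub s r hY hx hxY ε
  rw [h3, diff, diff, h4.2, h6, h7]
  field_simp

theorem exists_tendsto_div_curve [Finite ι] (hY : IsDiagonal c Y i j k) (hx : x ∈ c.V)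
    (hxY : x ∈ Y) {f : X → ℂ} (hf : f ∈ X.idealAt Y x) :
    ∃ b, Tendsto (fun ε => f (c.τ (c.curve j k x s r ε)) / ε) (𝓝[≠] 0) (𝓝 b) := by
  obtain ⟨a, b, ha, hb, h⟩ := exists_eq_mul_diff_add hY hx hxY hf
  exact ⟨_, tendsto_div_curve s r hY hx hxY ha hb h⟩

open Classical in
variable (c) in
/-- The derivative in the direction of a curve, on the ideal of the diagonal. -/
def slope (Y : Set X) (j k : ι) (x : X) (f : X → ℂ) : ℂ :=
  if f ∈ X.idealAt Y x then
    limUnder (𝓝[≠] 0) (fun ε => f (c.τ (c.curve j k x s r ε)) / ε) else 0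

/-- As a limit, the functional does not depend on the way `f` is written in terms of the generators,
and the axioms of a point of the blow-up follow by passing to the limit. -/
theorem tendsto_slope [Finite ι] (hY : IsDiagonal c Y i j k) (hx : x ∈ c.V)
    (hxY : x ∈ Y) {f : X → ℂ} (hf : f ∈ X.idealAt Y x) :
    Tendsto (fun ε => f (c.τ (c.curve j k x s r ε)) / ε) (𝓝[≠] 0) (𝓝 (c.slope s r Y j k x f)) := by
  obtain ⟨b, hb⟩ := exists_tendsto_div_curve s r hY hx hxY hf
  rw [slope, if_pos hf, hb.limUnder_eq]
  exact hb

theorem slope_eq [Finite ι] (hY : IsDiagonal c Y i j k) (hx : x ∈ c.V)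
    (hxY : x ∈ Y) {f a b : X → ℂ} (hf : f ∈ X.idealAt Y x) (ha : X.RegAt a x)
    (hb : X.RegAt b x) (h : ∀ᶠ y in 𝓝 x, f y = a y * c.diff i j y + b y * c.diff i k y) :
    c.slope s r Y j k x f = a x * s + b x * r :=
  tendsto_nhds_unique (tendsto_slope s r hY hx hxY hf) (tendsto_div_curve s r hY hx hxY ha hb h)

theorem slope_diff [Finite ι] (hY : IsDiagonal c Y i j k) (hx : x ∈ c.V) (hxY : x ∈ Y) :
    c.slope s r Y j k x (c.diff i j) = s ∧ c.slope s r Y j k x (c.diff i k) = r := by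
  have h0 := c.regAt_const hx 0
  have h1 := c.regAt_const hx 1
  obtain ⟨hu, hv⟩ := diff_mem_idealAt hY hx
  constructor
  · simpa using slope_eq s r hY hx hxY hu h1 h0 (by simp)
  · simpa using slope_eq s r hY hx hxY hv h0 h1 (by simp)

/-- The point of the blow-up over a point of the diagonal, in a given normal direction. -/
def fibrePoint [Finite ι] (hY : IsDiagonal c Y i j k) (hx : x ∈ c.V) (hxY : x ∈ Y)
    (h0 : s ≠ 0 ∨ r ≠ 0) : BlowUpPoint X Y :=
  BlowUpPoint.ofFunctional x (c.slope s r Y j k x)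
    (by
      intro h
      obtain ⟨h1, h2⟩ := slope_diff s r hY hx hxY
      rw [h, Pi.zero_apply] at h1 h2
      exact h0.elim (fun h => h h1.symm) (fun h => h h2.symm))
    (fun f hf => if_neg hf)
    (by
      intro a f g ha hf hg h
      refine tendsto_nhds_unique (tendsto_slope s r hY hx hxY hg) ?_
      refine Tendsto.congr' ?_ (((c.tendsto_regAt hx ha).comp
        ((tendsto_curve s r j k).mono_left nhdsWithin_le_nhds)).mul
        (tendsto_slope s r hY hx hxY hf))
      filter_upwards [(tendsto_τ_curve s r j k hx).eventually h] with ε hε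
      rw [hε, mul_div_assoc]
      rfl)
    (by
      intro n d f P hf hP h
      -- A homogeneous relation among the `f i` remains true after division of each of them by ε,
      -- and therefore holds for the limits.
      have h1 : Tendsto (fun ε => fun i => f i (c.τ (c.curve j k x s r ε)) / ε) (𝓝[≠] 0)
          (𝓝 (fun i => c.slope s r Y j k x (f i))) :=
        tendsto_pi_nhds.2 fun i => tendsto_slope s r hY hx hxY (hf i)
      refine tendsto_nhds_unique (((MvPolynomial.continuous_eval P).tendsto _).comp h1) ?_
      refine tendsto_const_nhds.congr' ?_
      filter_upwards [(tendsto_τ_curve s r j k hx).eventually h] with ε hε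
      simp only [Function.comp, div_eq_inv_mul]
      rw [eval_smul_of_isHomogeneous hP ε⁻¹ (fun i => f i (c.τ (c.curve j k x s r ε))), hε, mul_zero])

end Chart

theorem eventually_mul_add_ne_zero (a : ℂ) {b : ℂ} (hb : b ≠ 0) :
    ∀ᶠ ε in 𝓝[≠] (0 : ℂ), ε * (a + b * ε) ≠ 0 := by
  by_cases ha : a = 0
  · filter_upwards [self_mem_nhdsWithin] with ε hε
    have hε : ε ≠ 0 := hε
    simp [ha, hb, hε]
  · have hc : Continuous fun ε : ℂ => a + b * ε := by fun_prop
    filter_upwards [self_mem_nhdsWithin, ((hc.tendsto 0).mono_left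
      nhdsWithin_le_nhds).eventually_ne (b₂ := 0) (by simpa using ha)] with ε hε h
    exact mul_ne_zero hε h

namespace Chart

variable {X : FunSpace} {ι : Type} {c : Chart X ι} {i j k : ι} {Y : Set X} {x : X}

/-! ### The fibre over a point of the diagonal -/

section Fibre

variable [Finite ι] (hY : IsDiagonal c Y i j k)

include hY

/-- The coefficients depend on `f` and `x` alone, not on the point of the fibre; on the fibre each
element of the ideal thus becomes a fixed linear form in two coordinates. -/
theorem exists_coeff (hx : x ∈ c.V) (hxY : x ∈ Y) {f : X → ℂ} (hf : f ∈ X.idealAt Y x) :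
    ∃ a b : ℂ, ∀ ξ : BlowUpPoint X Y, ξ.base = x →
      ξ.dir.rep f = a * ξ.dir.rep (c.diff i j) + b * ξ.dir.rep (c.diff i k) := by
  obtain ⟨a, b, ha, hb, h⟩ := exists_eq_mul_diff_add hY hx hxY hf
  refine ⟨a x, b x, ?_⟩
  rintro ξ rfl
  exact rep_eq_of_eq_mul_diff_add hY ξ hx hf ha hb h

theorem rep_diff_ne_zero (ξ : BlowUpPoint X Y) (hx : ξ.base ∈ c.V) (hxY : ξ.base ∈ Y) :
    ξ.dir.rep (c.diff i j) ≠ 0 ∨ ξ.dir.rep (c.diff i k) ≠ 0 := by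
  obtain ⟨f, hf, h0⟩ := ξ.exists_mem_idealAt_rep_ne_zero
  obtain ⟨a, b, h⟩ := exists_coeff hY hx hxY hf
  by_contra! h'
  exact h0 (by rw [h ξ rfl, h'.1, h'.2]; simp)

theorem eq_of_rep_diff {ξ η : BlowUpPoint X Y} (h : ξ.base = η.base) (hx : η.base ∈ c.V)
    (hxY : η.base ∈ Y) (e : ℂ) (hj : ξ.dir.rep (c.diff i j) = e * η.dir.rep (c.diff i j))
    (hk : ξ.dir.rep (c.diff i k) = e * η.dir.rep (c.diff i k)) : ξ = η := by
  refine BlowUpPoint.ext_of_smul h e fun f => ?_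
  by_cases hf : f ∈ X.idealAt Y η.base
  · obtain ⟨a, b, hab⟩ := exists_coeff hY hx hxY hf
    rw [hab ξ h, hab η rfl, hj, hk]
    ring
  · rw [η.support f hf, ξ.support f (h ▸ hf), mul_zero]

theorem rep_fibrePoint [DecidableEq ι] (hx : x ∈ c.V) (hxY : x ∈ Y) {s r : ℂ}
    (h0 : s ≠ 0 ∨ r ≠ 0) : ∃ a : ℂ, a ≠ 0 ∧
      (fibrePoint s r hY hx hxY h0).dir.rep (c.diff i j) = a * s ∧
      (fibrePoint s r hY hx hxY h0).dir.rep (c.diff i k) = a * r := by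
  obtain ⟨a, ha, h⟩ := rep_mk_eq_mul (c.slope s r Y j k x) (by
    intro h
    obtain ⟨h1, h2⟩ := slope_diff s r hY hx hxY
    rw [h, Pi.zero_apply] at h1 h2
    exact h0.elim (fun h => h h1.symm) (fun h => h h2.symm))
  obtain ⟨h1, h2⟩ := slope_diff s r hY hx hxY
  refine ⟨a, ha, ?_, ?_⟩
  · exact (h _).trans (by rw [h1])
  · exact (h _).trans (by rw [h2])

/-- The fibre of the blow-up over a point of the diagonal is a projective line. -/
theorem exists_iso_fibre (hx : x ∈ c.V) (hxY : x ∈ Y) {S : Set (X.blowUp Y)}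
    (hS : ∀ ξ, ξ ∈ S ↔ X.blowDown Y ξ = x) :
    ∃ e : Iso ((X.blowUp Y).sub S) (proj 2), ∀ ξ : S, ∃ h, e.toEquiv ξ =
      Projectivization.mk ℂ ![(BlowUpPoint.dir ξ.1).rep (c.diff i j),
        (BlowUpPoint.dir ξ.1).rep (c.diff i k)] h := by
  classical
  have hb : ∀ ξ : S, BlowUpPoint.base ξ.1 = x := fun ξ => (hS _).1 ξ.2
  have hbV : ∀ ξ : S, BlowUpPoint.base ξ.1 ∈ c.V := fun ξ => by rw [hb]; exact hx
  have hbY : ∀ ξ : S, BlowUpPoint.base ξ.1 ∈ Y := fun ξ => by rw [hb]; exact hxY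
  have hne : ∀ ξ : S, (![(BlowUpPoint.dir ξ.1).rep (c.diff i j),
      (BlowUpPoint.dir ξ.1).rep (c.diff i k)] : Fin 2 → ℂ) ≠ 0 := by
    intro ξ h
    have h1 := congrFun h 0
    have h2 := congrFun h 1
    rcases rep_diff_ne_zero hY ξ.1 (hbV ξ) (hbY ξ) with h' | h'
    exacts [h' h1, h' h2]
  have hz : ∀ z : proj 2, Projectivization.rep z 0 ≠ 0 ∨ Projectivization.rep z 1 ≠ 0 := by
    intro z
    by_contra! h
    refine Projectivization.rep_nonzero z (funext fun l => ?_)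
    fin_cases l
    exacts [h.1, h.2]
  let pt : proj 2 → X.blowUp Y := fun z => fibrePoint _ _ hY hx hxY (hz z)
  let e : (X.blowUp Y).sub S ≃ proj 2 :=
    { toFun := fun ξ => Projectivization.mk ℂ _ (hne ξ)
      invFun := fun z => ⟨pt z, (hS _).2 rfl⟩
      left_inv := by
        intro ξ
        refine Subtype.ext ?_
        obtain ⟨a, ha, h1, h2⟩ := rep_fibrePoint hY hx hxY (hz (Projectivization.mk ℂ _ (hne ξ)))
        obtain ⟨b, hb0, h3⟩ := rep_mk_eq_mul _ (hne ξ)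
        refine eq_of_rep_diff hY (hb ξ).symm (hbV ξ) (hbY ξ)
          (a * b) ?_ ?_
        · exact h1.trans (by rw [h3]; simp [mul_assoc])
        · exact h2.trans (by rw [h3]; simp [mul_assoc])
      right_inv := by
        intro z
        obtain ⟨a, ha, h1, h2⟩ := rep_fibrePoint hY hx hxY (hz z)
        refine Eq.trans ((Projectivization.mk_eq_mk_iff' ℂ _ _ _ _).2 ⟨a, ?_⟩)
          (Projectivization.mk_rep z)
        funext l
        fin_cases l
        exacts [h1.symm, h2.symm] }
  -- On the fibre, elements of the ideal are linear forms in the coordinates of `z`, up to a common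
  -- scalar. Continuity and regularity of the inverse thus reduce to substituting linear forms into
  -- polynomials.
  have hval : ∀ (n : ℕ) (f : Fin n → X → ℂ), (∀ l, f l ∈ X.idealAt Y x) →
      ∃ T : (Fin 2 → ℂ) →ₗ[ℂ] (Fin n → ℂ), ∀ z, ∃ a : ℂ, a ≠ 0 ∧
        ∀ l, (BlowUpPoint.dir (pt z)).rep (f l) = a * T (Projectivization.rep z) l := by
    intro n f hf
    choose a b hab using fun l => exists_coeff hY hx hxY (hf l)
    refine ⟨LinearMap.pi fun l => a l • LinearMap.proj 0 + b l • LinearMap.proj 1, fun z => ?_⟩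
    obtain ⟨u, hu, h1, h2⟩ := rep_fibrePoint hY hx hxY (hz z)
    refine ⟨u, hu, fun l => ?_⟩
    rw [hab l (pt z) rfl]
    refine (congrArg₂ (fun p q => a l * p + b l * q) h1 h2).trans ?_
    simp
    ring
  have hpt : Continuous pt := by
    refine continuous_generateFrom_iff.2 ?_
    rintro _ ⟨U, n, d, f, P, hU, hf, hP, rfl⟩
    by_cases hxU : x ∈ U
    · obtain ⟨T, hT⟩ := hval n f (hf x hxU)
      obtain ⟨P', hP', h⟩ := exists_isHomogeneous_comp_linear T hP
      convert isOpen_proj hP' using 1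
      ext z
      obtain ⟨a, ha, h1⟩ := hT z
      change (x ∈ U ∧ BlowUpPoint.value (pt z) f P ≠ 0) ↔ eval (Projectivization.rep z) P' ≠ 0
      rw [BlowUpPoint.value_smul hP h1, h]
      simp [hxU, ha]
    · convert isOpen_empty
      ext z
      exact ⟨fun h => hxU h.1, fun h => h.elim⟩
  refine ⟨⟨e, ?_, ?_⟩, fun ξ => ⟨hne ξ, rfl⟩⟩
  · refine isMorphism_mk_rep (g := ![c.diff i j, c.diff i k]) c.isOpen_V ?_
      (fun ξ hξ => by rw [(hS ξ).1 hξ]; exact hx) fun ξ => ?_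
    · intro y hy l
      fin_cases l
      exacts [(diff_mem_idealAt hY hy).1, (diff_mem_idealAt hY hy).2]
    · have h : (fun l => (BlowUpPoint.dir ξ.1).rep ((![c.diff i j, c.diff i k] : Fin 2 → X → ℂ) l))
          = ![(BlowUpPoint.dir ξ.1).rep (c.diff i j), (BlowUpPoint.dir ξ.1).rep (c.diff i k)] := by
        funext l
        fin_cases l <;> rfl
      simp only [h]
      exact ⟨hne ξ, rfl⟩
  · refine IsMorphism.codRestrict (isLocal_proj 2) ⟨hpt, ?_⟩
    rintro z F ⟨n, d, f, P, Q, hf, hP, hQ, h0, hF⟩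
    obtain ⟨T, hT⟩ := hval n f hf
    obtain ⟨P', hP', hPe⟩ := exists_isHomogeneous_comp_linear T hP
    obtain ⟨Q', hQ', hQe⟩ := exists_isHomogeneous_comp_linear T hQ
    refine regAt_proj.2 ⟨d, P', Q', hP', hQ', ?_, ?_⟩
    · obtain ⟨a, ha, h1⟩ := hT z
      have h0' : BlowUpPoint.value (pt z) f Q ≠ 0 := h0
      rw [BlowUpPoint.value_smul hQ h1] at h0'
      rw [hQe]
      exact right_ne_zero_of_mul h0'
    · filter_upwards [(hpt.tendsto z).eventually hF] with y hy
      obtain ⟨a, ha, h1⟩ := hT y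
      change F (pt y) = _
      rw [hy, BlowUpPoint.value_smul hP h1, BlowUpPoint.value_smul hQ h1, hPe, hQe,
        mul_div_mul_left _ _ (pow_ne_zero _ ha)]

end Fibre

/-- Each point over the diagonal is the limit of a curve of points off the exceptional divisor;
regular functions are continuous along the curve. -/
theorem exists_curve [Finite ι] [DecidableEq ι] (hY : IsDiagonal c Y i j k) (ξ : X.blowUp Y)
    (hx : X.blowDown Y ξ ∈ c.V) (hxY : X.blowDown Y ξ ∈ Y) :
    ∃ (s r : ℂ) (g : ℂ → X.blowUp Y), Tendsto g (𝓝[≠] 0) (𝓝 ξ) ∧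
      (∀ᶠ ε in 𝓝[≠] 0, X.blowDown Y (g ε) ∈ c.V ∧
        c.t (X.blowDown Y (g ε)) = c.curve j k (X.blowDown Y ξ) s r ε) ∧
      ∀ F, (X.blowUp Y).RegAt F ξ → Tendsto (fun ε => F (g ε)) (𝓝[≠] 0) (𝓝 (F ξ)) := by
  classical
  set x := X.blowDown Y ξ with hxdef
  set s := (BlowUpPoint.dir ξ).rep (c.diff i j) with hs
  set r := (BlowUpPoint.dir ξ).rep (c.diff i k) with hr
  have hsr : s ≠ 0 ∨ r ≠ 0 := rep_diff_ne_zero hY ξ hx hxY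
  -- The lift of the curve to the blow-up, unique off the centre; the value `ξ` elsewhere is a
  -- default.
  let g : ℂ → X.blowUp Y := fun ε => show BlowUpPoint X Y from
    if h : c.τ (c.curve j k x s r ε) ∈ c.V ∧ c.τ (c.curve j k x s r ε) ∉ Y then
      c.unitPoint h.1 (eventually_notMem hY h.1 h.2) else ξ
  have hoff : ∀ᶠ ε in 𝓝[≠] 0, c.τ (c.curve j k x s r ε) ∈ c.V ∧
      c.τ (c.curve j k x s r ε) ∉ Y := by
    have h1 : ∀ᶠ ε in 𝓝[≠] (0 : ℂ), ε * (s + ε) ≠ 0 := by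
      simpa using eventually_mul_add_ne_zero s one_ne_zero
    filter_upwards [h1, eventually_t_τ_curve s r j k hx] with ε h1 h2
    refine ⟨h2.1, fun h => h1 ?_⟩
    rw [← (curve_sub s r hY hx hxY ε).1, ← h2.2, ((hY.mem_iff _ h2.1).1 h).1, sub_self]
  have hbase : ∀ᶠ ε in 𝓝[≠] 0, X.blowDown Y (g ε) = c.τ (c.curve j k x s r ε) := by
    filter_upwards [hoff] with ε h
    have hg : g ε = c.unitPoint h.1 (eventually_notMem hY h.1 h.2) := dif_pos h
    rw [hg]
    rfl
  -- The functional at `g ε` is evaluation up to a scalar; normalising this scalar by 1/ε makes the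
  -- functionals converge to the one at `ξ`.
  have hrep : ∀ᶠ ε in 𝓝[≠] 0, ∃ a : ℂ, a ≠ 0 ∧ ∀ f, X.RegAt f (c.τ (c.curve j k x s r ε)) →
      (BlowUpPoint.dir (g ε)).rep f = a * (f (c.τ (c.curve j k x s r ε)) / ε) := by
    filter_upwards [hoff, hbase, self_mem_nhdsWithin] with ε h1 h2 h3
    have h3 : ε ≠ 0 := h3
    change BlowUpPoint.base (g ε) = _ at h2
    obtain ⟨a, ha, h⟩ := c.rep_eq_of_eventually_notMem (g ε) (by rw [h2]; exact h1.1)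
      (by rw [h2]; exact eventually_notMem hY h1.1 h1.2)
    rw [h2] at h
    refine ⟨a * ε, mul_ne_zero ha h3, fun f hf => ?_⟩
    rw [h f hf]
    field_simp
  have hlim : ∀ (n : ℕ) (f : Fin n → X → ℂ), (∀ l, f l ∈ X.idealAt Y x) →
      ∀ P : MvPolynomial (Fin n) ℂ, Tendsto
        (fun ε => eval (fun l => f l (c.τ (c.curve j k x s r ε)) / ε) P) (𝓝[≠] 0)
        (𝓝 (BlowUpPoint.value ξ f P)) := by
    intro n f hf P
    refine ((MvPolynomial.continuous_eval P).tendsto _).comp (tendsto_pi_nhds.2 fun l => ?_)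
    obtain ⟨a, b, ha, hb, h⟩ := exists_eq_mul_diff_add hY hx hxY (hf l)
    rw [rep_eq_of_eq_mul_diff_add hY ξ hx (hf l) ha hb h]
    exact tendsto_div_curve s r hY hx hxY ha hb h
  have hτ := tendsto_τ_curve s r j k hx
  have hg : Tendsto (β := X.blowUp Y) g (𝓝[≠] 0) (𝓝 ξ) := by
    refine tendsto_blowUp (hτ.congr' (hbase.mono fun _ h => h.symm)) ?_
    intro n d f P hP hf h0
    filter_upwards [hrep, hτ.eventually hf,
      (hlim n f (fun l => hf.self_of_nhds l) P).eventually_ne h0] with ε ⟨a, ha, h1⟩ h2 h3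
    rw [BlowUpPoint.value_smul hP (fun l => h1 (f l) (h2 l).1)]
    exact mul_ne_zero (pow_ne_zero _ ha) h3
  refine ⟨s, r, g, hg, ?_, ?_⟩
  · filter_upwards [hbase, eventually_t_τ_curve s r j k hx] with ε h1 h2
    rw [h1]
    exact h2
  · rintro F ⟨n, d, f, P, Q, hf, hP, hQ, h0, hF⟩
    have hreg : ∀ᶠ y in 𝓝 x, ∀ l, X.RegAt (f l) y :=
      eventually_all.2 fun l => c.eventually_regAt hx (hf l).1
    have hF : ∀ᶠ η : X.blowUp Y in 𝓝 ξ,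
        F η = BlowUpPoint.value η f P / BlowUpPoint.value η f Q := hF
    rw [hF.self_of_nhds]
    refine ((hlim n f hf P).div (hlim n f hf Q) h0).congr' ?_
    filter_upwards [hrep, hτ.eventually hreg, hg.eventually hF] with ε ⟨a, ha, h1⟩ h2 h3
    rw [h3, BlowUpPoint.value_smul hP (fun l => h1 (f l) (h2 l)),
      BlowUpPoint.value_smul hQ (fun l => h1 (f l) (h2 l)), mul_div_mul_left _ _ (pow_ne_zero _ ha)]
    rfl

end Chart

section Parametrisation

/-! ### Sextuples that are injective up to coincidences among `A`, `B`, `C` -/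

/-- The letters `A`, `B`, `C`. -/
def lettersABC : Finset Letter := {Letter.A, Letter.B, Letter.C}

/-- Only the images of `A`, `B`, `C` may coincide. -/
def OnlyABCMeet {α : Type} (g : Letter → α) : Prop :=
  ∀ x y, x ≠ y → ¬(x ∈ lettersABC ∧ y ∈ lettersABC) → g x ≠ g y

section Combinatorics

variable {g : Letter → Plane} (hg : OnlyABCMeet g)

include hg

/-- Each of D, E, F is alone in its block. This excludes the types (3,2,1), (4,1,1), (2,2,2) and
(2,2,1,1) at once. -/
theorem three_le_count_one {π : Finpartition (Finset.univ : Finset Letter)}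
    (hπ : g ∈ polydiagonal π) : 3 ≤ (partitionType π).count 1 := by
  have hs : ∀ x, x ∉ lettersABC → {x} ∈ π.parts := by
    intro x hx
    obtain ⟨b, hb, hxb⟩ := π.exists_mem (Finset.mem_univ x)
    suffices h : b = {x} by rwa [← h]
    refine Finset.eq_singleton_iff_unique_mem.2 ⟨hxb, fun y hy => ?_⟩
    by_contra hne
    exact hg y x hne (fun h => hx h.2) (hπ b hb y hy x hxb)
  rw [partitionType, Multiset.count_map]
  have h3 : (({{Letter.D}, {Letter.E}, {Letter.F}} : Finset (Finset Letter))).card = 3 := by decide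
  rw [← h3, ← Finset.filter_val, Finset.card_val]
  refine Finset.card_le_card fun b hb => ?_
  simp only [Finset.mem_insert, Finset.mem_singleton] at hb
  rw [Finset.mem_filter]
  rcases hb with rfl | rfl | rfl <;> exact ⟨hs _ (by decide), rfl⟩

theorem notMem_polydiagonalsOfType {T : Multiset ℕ} (hT : T.count 1 < 3) :
    g ∉ polydiagonalsOfType T := by
  rintro ⟨π, rfl, hπ⟩
  exact absurd (three_le_count_one hg hπ) (by omega)

theorem mem_polydiagonalsOfType_iff : g ∈ polydiagonalsOfType {3, 1, 1, 1} ↔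
    g Letter.B = g Letter.A ∧ g Letter.C = g Letter.A := by
  constructor
  · rintro ⟨π, hT, hπ⟩
    have h3 : 3 ∈ partitionType π := by rw [hT]; decide
    obtain ⟨b, hb, hcard⟩ := Multiset.mem_map.1 h3
    -- A letter other than A, B, C cannot share its value with a second letter of the block.
    have hsub : b ⊆ lettersABC := by
      intro x hx
      by_contra hx'
      obtain ⟨y, hy, hne⟩ := Finset.exists_mem_ne (by omega : 1 < b.card) x
      exact hg y x hne (fun h => hx' h.2) (hπ b hb y hy x hx)
    have hb' : b = lettersABC := Finset.eq_of_subset_of_card_le hsub (by rw [hcard]; decide)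
    subst hb'
    exact ⟨hπ _ hb _ (by decide) _ (by decide), hπ _ hb _ (by decide) _ (by decide)⟩
  · rintro ⟨hB, hC⟩
    obtain ⟨T, hT⟩ : ∃ T : Finset (Finset Letter),
        T = {lettersABC, {Letter.D}, {Letter.E}, {Letter.F}} := ⟨_, rfl⟩
    have hs : T.SupIndep id := by
      rw [Finset.supIndep_iff_pairwiseDisjoint, hT]
      intro x hx y hy hxy
      simp only [Finset.coe_insert, Finset.coe_singleton, Set.mem_insert_iff,
        Set.mem_singleton_iff] at hx hy
      rcases hx with rfl | rfl | rfl | rfl <;> rcases hy with rfl | rfl | rfl | rfl <;>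
        first
        | exact absurd rfl hxy
        | simp only [Function.onFun, id]; decide
    have hsup : T.sup id = Finset.univ := by
      ext x
      cases x <;> simp [hT, lettersABC]
    have hbot : ∅ ∉ T := by
      rw [hT]
      decide
    refine ⟨⟨T, hs, hsup, hbot⟩, ?_, ?_⟩
    · change Multiset.map Finset.card T.val = _
      rw [hT]
      decide
    · intro b hb x hx y hy
      change b ∈ T at hb
      simp only [hT, Finset.mem_insert, Finset.mem_singleton] at hb
      rcases hb with rfl | rfl | rfl | rfl
      · simp only [lettersABC, Finset.mem_insert, Finset.mem_singleton] at hx hy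
        rcases hx with rfl | rfl | rfl <;> rcases hy with rfl | rfl | rfl <;> simp [hB, hC]
      all_goals
        rw [Finset.mem_singleton] at hx hy
        rw [hx, hy]

theorem mem_openSextuples (hc : ∀ x, g x ∈ conic) :
    (∀ x, g x ∈ conic) ∧ g ∉ polydiagonalsOfType {3, 2, 1} ∧
      g ∉ polydiagonalsOfType {4, 1, 1} :=
  ⟨hc, notMem_polydiagonalsOfType hg (by decide), notMem_polydiagonalsOfType hg (by decide)⟩

end Combinatorics

/-! ### A parametrisation of the conic -/

variable (lam : ℂ)

/-- The denominator of the parameter on the conic. -/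
def denom (z : Fin 3 → ℂ) : ℂ := z 0 + 2 * lam * z 1 + lam ^ 2 * z 2

/-- The parameter on the conic. -/
def param (z : Fin 3 → ℂ) : ℂ := (z 1 + lam * z 2) / denom lam z

/-- The point on the conic with given parameter. -/
def vero (t : ℂ) : Fin 3 → ℂ := ![(1 - lam * t) ^ 2, (1 - lam * t) * t, t ^ 2]

/-- For z = (σ², στ, τ²) the form `denom` is (σ + lam τ)², whose line is tangent to the conic at
(lam², -lam, 1), and the parameter is τ/(σ + lam τ). The vector `vero` is normalised by σ + lam τ =
1, so `denom` is the scalar that relates any representative to it. -/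
theorem denom_vero (t : ℂ) : denom lam (vero lam t) = 1 := by
  simp [denom, vero]
  ring

theorem vero_ne_zero (t : ℂ) : vero lam t ≠ 0 := by
  intro h
  have := denom_vero lam t
  rw [h] at this
  simp [denom] at this

theorem param_vero (t : ℂ) : param lam (vero lam t) = t := by
  rw [param, denom_vero]
  simp [vero]
  ring

variable {lam} in
theorem eq_denom_mul_vero {z : Fin 3 → ℂ} (hz : z 0 * z 2 = z 1 ^ 2) (h0 : denom lam z ≠ 0)
    (i : Fin 3) : z i = denom lam z * vero lam (param lam z) i := by
  have h1 : 1 - lam * param lam z = (z 0 + lam * z 1) / denom lam z := by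
    rw [param, eq_div_iff h0, sub_mul, ← mul_div_assoc, div_mul_cancel₀ _ h0, denom]
    ring
  have h2 : param lam z = (z 1 + lam * z 2) / denom lam z := rfl
  fin_cases i <;> simp only [vero, h1] <;> rw [h2] <;> simp <;> field_simp <;> simp only [denom] <;>
    first
    | linear_combination (lam ^ 2) * hz
    | linear_combination (-lam) * hz
    | linear_combination hz

/-- The point on the conic with given parameter. -/
def conicPoint (t : ℂ) : Plane := Projectivization.mk ℂ (vero lam t) (vero_ne_zero lam t)

theorem exists_rep_conicPoint (t : ℂ) : ∃ a : ℂ, a ≠ 0 ∧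
    ∀ i, (conicPoint lam t).rep i = a * vero lam t i :=
  rep_mk_eq_mul _ _

theorem param_rep_conicPoint (t : ℂ) : param lam (conicPoint lam t).rep = t := by
  obtain ⟨a, ha, h⟩ := exists_rep_conicPoint lam t
  conv_rhs => rw [← param_vero lam t]
  have h1 : denom lam (conicPoint lam t).rep = a * denom lam (vero lam t) := by
    simp only [denom, h]
    ring
  rw [param, h1, h, h, param, denom_vero]
  field_simp

theorem conicPoint_mem_conic (t : ℂ) : conicPoint lam t ∈ conic := by
  obtain ⟨a, ha, h⟩ := exists_rep_conicPoint lam t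
  change _ * _ = _ ^ 2
  rw [h, h, h]
  simp [vero]
  ring

variable {lam} in
theorem conicPoint_param {z : Plane} (hz : z ∈ conic) (h0 : denom lam z.rep ≠ 0) :
    conicPoint lam (param lam z.rep) = z := by
  conv_rhs => rw [← Projectivization.mk_rep z]
  refine ((Projectivization.mk_eq_mk_iff' ℂ _ _ _ _).2 ⟨denom lam z.rep, ?_⟩).symm
  funext i
  exact (eq_denom_mul_vero hz h0 i).symm

theorem onlyABCMeet_conicPoint {v : Letter → ℂ} (hv : OnlyABCMeet v) :
    OnlyABCMeet fun x => conicPoint lam (v x) := by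
  intro x y h1 h2 h3
  refine hv x y h1 h2 ?_
  change conicPoint lam (v x) = conicPoint lam (v y) at h3
  rw [← param_rep_conicPoint lam (v x), h3, param_rep_conicPoint]

theorem eventually_onlyABCMeet {v₀ : Letter → ℂ} (h : OnlyABCMeet v₀) :
    ∀ᶠ v in 𝓝 v₀, OnlyABCMeet v := by
  refine eventually_all.2 fun x => eventually_all.2 fun y => ?_
  by_cases hxy : x ≠ y ∧ ¬(x ∈ lettersABC ∧ y ∈ lettersABC)
  · have hc : Continuous fun v : Letter → ℂ => v x - v y := by fun_prop
    filter_upwards [(hc.tendsto v₀).eventually_ne (sub_ne_zero.2 (h x y hxy.1 hxy.2))] with v hv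
    exact fun _ _ => sub_ne_zero.1 hv
  · exact Eventually.of_forall fun v h1 h2 => absurd ⟨h1, h2⟩ hxy

/-- Evaluation of multihomogeneous polynomials at a sextuple on the conic. -/
theorem eval_multihomogeneous {z : Letter → Plane} {b : Letter → ℂ} {v : Letter → ℂ}
    (hz : ∀ x i, (z x).rep i = b x * vero lam (v x) i) {d : Letter → ℕ}
    {P : MvPolynomial (Letter × Fin 3) ℂ}
    (hP : IsWeightedHomogeneous (fun p : Letter × Fin 3 => (Pi.single p.1 1 : Letter → ℕ)) P d) :
    eval (fun p : Letter × Fin 3 => (z p.1).rep p.2) P =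
      (∏ x, b x ^ d x) * eval (fun p : Letter × Fin 3 => vero lam (v p.1) p.2) P := by
  -- The character of the multigrading that rescales the coordinates of the point of letter x by `b
  -- x`.
  let χ : Multiplicative (Letter → ℕ) →* ℂ :=
    { toFun := fun d => ∏ x, b x ^ d.toAdd x
      map_one' := by simp
      map_mul' := fun d e => by simp [pow_add, Finset.prod_mul_distrib] }
  have h := eval_scale_of_isWeightedHomogeneous hP χ
    (fun p : Letter × Fin 3 => vero lam (v p.1) p.2)
  have hχ : ∀ x, χ (.ofAdd (Pi.single x 1)) = b x := by
    intro x
    change ∏ y, b y ^ (Pi.single x 1 : Letter → ℕ) y = b x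
    rw [Finset.prod_eq_single x] <;> simp +contextual
  simp only [hχ] at h
  simp only [hz]
  exact h

theorem exists_polynomial_param (P : MvPolynomial (Letter × Fin 3) ℂ) :
    ∃ p : MvPolynomial Letter ℂ, ∀ v : Letter → ℂ,
      eval v p = eval (fun q : Letter × Fin 3 => vero lam (v q.1) q.2) P := by
  refine ⟨bind₁ (fun q : Letter × Fin 3 => (![(1 - C lam * X q.1) ^ 2, (1 - C lam * X q.1) * X q.1,
    X q.1 ^ 2] : Fin 3 → MvPolynomial Letter ℂ) q.2) P, fun v => ?_⟩
  rw [← MvPolynomial.aeval_eq_eval, ← MvPolynomial.aeval_eq_eval]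
  simp only [aeval_bind₁]
  congr 2
  funext ⟨x, i⟩
  fin_cases i <;> simp [vero]

/-- The parameters of a sextuple. -/
def params (z : Letter → Plane) (x : Letter) : ℂ := param lam (z x).rep

theorem eventually_denom_ne_zero {z : multiProj Letter 3} {x : Letter}
    (h : denom lam (Projectivization.rep (z x)) ≠ 0) :
    ∀ᶠ y : multiProj Letter 3 in 𝓝 z, denom lam (Projectivization.rep (y x)) ≠ 0 := by
  have hS : IsWeightedHomogeneous (fun p : Letter × Fin 3 => (Pi.single p.1 1 : Letter → ℕ))
      (X (x, 0) + C (2 * lam) * X (x, 1) + C (lam ^ 2) * X (x, 2) :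
        MvPolynomial (Letter × Fin 3) ℂ) (Pi.single x 1) :=
    ((isWeightedHomogeneous_X ℂ _ (x, 0)).add ((isWeightedHomogeneous_X ℂ _ (x, 1)).C_mul _)).add
      ((isWeightedHomogeneous_X ℂ _ (x, 2)).C_mul _)
  refine Eventually.mono (eventually_eval_ne_zero (a := z)
    (coord := fun (z : Letter → Plane) (p : Letter × Fin 3) => (z p.1).rep p.2) hS
    (by simpa [denom] using h)) fun y hy => ?_
  simpa [denom] using hy

theorem regAt_params {z : multiProj Letter 3} {x : Letter}
    (h : denom lam (Projectivization.rep (z x)) ≠ 0) :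
    (multiProj Letter 3).RegAt (fun y => params lam y x) z := by
  refine regAt_ofCoordinates.2 ⟨Pi.single x 1, X (x, 1) + C lam * X (x, 2),
    X (x, 0) + C (2 * lam) * X (x, 1) + C (lam ^ 2) * X (x, 2),
    (isWeightedHomogeneous_X ℂ _ (x, 1)).add ((isWeightedHomogeneous_X ℂ _ (x, 2)).C_mul _),
    ((isWeightedHomogeneous_X ℂ _ (x, 0)).add ((isWeightedHomogeneous_X ℂ _ (x, 1)).C_mul _)).add
      ((isWeightedHomogeneous_X ℂ _ (x, 2)).C_mul _), by simpa [denom] using h, ?_⟩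
  exact Eventually.of_forall fun y => by simp [params, param, denom]

/-- The sextuples that have parameters, with coincidences only among `A`, `B`, `C`. -/
def parametrised : Set openSextuples :=
  {h | (∀ x, denom lam (sextuple h x).rep ≠ 0) ∧ OnlyABCMeet (params lam (sextuple h))}

open Classical in
/-- The sextuple with given parameters. -/
def ofParams (h₀ : openSextuples) (v : Letter → ℂ) : openSextuples :=
  if hv : OnlyABCMeet v then
    (⟨fun x => conicPoint lam (v x), mem_openSextuples (onlyABCMeet_conicPoint lam hv)
      fun x => conicPoint_mem_conic lam (v x)⟩ : Subtype _)
  else h₀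

variable {lam}

theorem sextuple_ofParams (h₀ : openSextuples) {v : Letter → ℂ} (hv : OnlyABCMeet v) :
    sextuple (ofParams lam h₀ v) = fun x => conicPoint lam (v x) := by
  have h : ofParams lam h₀ v = (⟨fun x => conicPoint lam (v x),
      mem_openSextuples (onlyABCMeet_conicPoint lam hv)
        fun x => conicPoint_mem_conic lam (v x)⟩ : Subtype _) := dif_pos hv
  rw [h]
  rfl

theorem params_ofParams (h₀ : openSextuples) {v : Letter → ℂ} (hv : OnlyABCMeet v) :
    params lam (sextuple (ofParams lam h₀ v)) = v := by
  rw [sextuple_ofParams h₀ hv]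
  exact funext fun x => param_rep_conicPoint lam (v x)

theorem conicPoint_params {h : openSextuples} (hh : h ∈ parametrised lam) (x : Letter) :
    conicPoint lam (params lam (sextuple h) x) = sextuple h x :=
  conicPoint_param (h.2.1 x) (hh.1 x)

/-- Up to a non-zero factor, a multihomogeneous form at a sextuple is a polynomial in the
parameters, and the non-vanishing of a polynomial is an open condition in the Euclidean topology. -/
theorem tendsto_ofParams (h₀ : openSextuples) {h : openSextuples} (hh : h ∈ parametrised lam) :
    Tendsto (ofParams lam h₀) (𝓝 (params lam (sextuple h))) (𝓝 h) := by
  refine tendsto_subtype_rng.2 ?_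
  refine TopologicalSpace.tendsto_nhds_generateFrom_iff.2 ?_
  rintro _ ⟨d, Q, hQ, rfl⟩ h1
  have h1 : eval (fun p : Letter × Fin 3 => (sextuple h p.1).rep p.2) Q ≠ 0 := h1
  rw [eval_multihomogeneous lam (z := sextuple h) (v := params lam (sextuple h))
    (fun x i => eq_denom_mul_vero (h.2.1 x) (hh.1 x) i) hQ] at h1
  have hc : Continuous fun v : Letter → ℂ =>
      eval (fun p : Letter × Fin 3 => vero lam (v p.1) p.2) Q := by
    obtain ⟨q, hq⟩ := exists_polynomial_param lam Q
    simpa only [hq] using MvPolynomial.continuous_eval q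
  filter_upwards [(hc.tendsto _).eventually_ne (right_ne_zero_of_mul h1),
    eventually_onlyABCMeet hh.2] with v hv hv'
  change eval (fun p : Letter × Fin 3 => (sextuple (ofParams lam h₀ v) p.1).rep p.2) Q ≠ 0
  rw [sextuple_ofParams h₀ hv']
  choose b hb0 hb using fun x => exists_rep_conicPoint lam (v x)
  rw [eval_multihomogeneous lam hb hQ]
  exact mul_ne_zero (Finset.prod_ne_zero_iff.2 fun x _ => pow_ne_zero _ (hb0 x)) hv

theorem regAt_eval_params {h : openSextuples} (hh : h ∈ parametrised lam)
    (p : MvPolynomial Letter ℂ) :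
    (multiProj Letter 3).RegAt (fun z => eval (params lam z) p) h.1 :=
  RegAt.eval (u := fun x z => params lam z x) (fun x => regAt_params lam (hh.1 x)) p

theorem isOpen_parametrised_ne (q : MvPolynomial Letter ℂ) :
    IsOpen {h | h ∈ parametrised lam ∧ eval (params lam (sextuple h)) q ≠ 0} := by
  refine isOpen_iff_mem_nhds.2 ?_
  rintro h ⟨hh, hq⟩
  have hval : Tendsto (fun y : openSextuples => (y.1 : multiProj Letter 3)) (𝓝 h) (𝓝 h.1) :=
    continuous_subtype_val.tendsto h
  have h1 : ∀ᶠ y : openSextuples in 𝓝 h, ∀ x, denom lam (sextuple y x).rep ≠ 0 :=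
    eventually_all.2 fun x => hval.eventually (eventually_denom_ne_zero lam (hh.1 x))
  have h2 : ∀ᶠ y : openSextuples in 𝓝 h, OnlyABCMeet (params lam (sextuple y)) := by
    refine eventually_all.2 fun x => eventually_all.2 fun y => ?_
    by_cases hxy : x ≠ y ∧ ¬(x ∈ lettersABC ∧ y ∈ lettersABC)
    · have h3 := hval.eventually (RegAt.eventually_ne_zero (regAt_eval_params hh (X x - X y))
        (by simpa [sub_eq_zero] using! hh.2 x y hxy.1 hxy.2))
      filter_upwards [h3] with z hz _ _ h'
      exact hz (by simpa [sub_eq_zero] using! h')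
    · exact Eventually.of_forall fun v h1 h2 => absurd ⟨h1, h2⟩ hxy
  have h3 := hval.eventually (RegAt.eventually_ne_zero (regAt_eval_params hh q) hq)
  filter_upwards [h1, h2, h3] with y h4 h5 h6
  exact ⟨⟨h4, h5⟩, h6⟩

/-- Numerator and denominator have the same multidegree, so the powers of `denom` cancel and a
quotient of polynomials in the parameters remains. Conversely, the parameters themselves are
regular. -/
theorem regAt_openSextuples {h : openSextuples} (hh : h ∈ parametrised lam)
    (f : openSextuples → ℂ) : openSextuples.RegAt f h ↔
      ∃ p q : MvPolynomial Letter ℂ, eval (params lam (sextuple h)) q ≠ 0 ∧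
        ∀ᶠ y in 𝓝 h, f y = eval (params lam (sextuple y)) p / eval (params lam (sextuple y)) q := by
  have hval : Tendsto (fun y : openSextuples => (y.1 : multiProj Letter 3)) (𝓝 h) (𝓝 h.1) :=
    continuous_subtype_val.tendsto h
  have hev : ∀ {y : openSextuples}, y ∈ parametrised lam →
      ∀ {d : Letter → ℕ} {P : MvPolynomial (Letter × Fin 3) ℂ},
      IsWeightedHomogeneous (fun p : Letter × Fin 3 => (Pi.single p.1 1 : Letter → ℕ)) P d →
      eval (fun p : Letter × Fin 3 => (sextuple y p.1).rep p.2) P =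
        (∏ x, denom lam (sextuple y x).rep ^ d x) *
          eval (fun p : Letter × Fin 3 => vero lam (params lam (sextuple y) p.1) p.2) P :=
    fun {y} hy {d P} hP => eval_multihomogeneous lam
      (fun x i => eq_denom_mul_vero (y.2.1 x) (hy.1 x) i) hP
  constructor
  · rintro ⟨F, hF, hfF⟩
    obtain ⟨d, P, Q, hP, hQ, h0, hPQ⟩ := regAt_ofCoordinates.1 hF
    obtain ⟨p, hp⟩ := exists_polynomial_param lam P
    obtain ⟨q, hq⟩ := exists_polynomial_param lam Q
    refine ⟨p, q, ?_, ?_⟩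
    · have h1 : eval (fun p : Letter × Fin 3 => (sextuple h p.1).rep p.2) Q ≠ 0 := h0
      rw [hev hh hQ] at h1
      rw [hq]
      exact right_ne_zero_of_mul h1
    · have hV : ∀ᶠ y in 𝓝 h, y ∈ parametrised lam :=
        (by simpa using isOpen_parametrised_ne (lam := lam) 1 : IsOpen (parametrised lam)).mem_nhds hh
      filter_upwards [hfF, hval.eventually hPQ, hV] with y h1 h2 h3
      rw [h1, h2, hp, hq]
      change eval (fun p : Letter × Fin 3 => (sextuple y p.1).rep p.2) P /
        eval (fun p : Letter × Fin 3 => (sextuple y p.1).rep p.2) Q = _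
      rw [hev h3 hP, hev h3 hQ]
      exact mul_div_mul_left _ _ (Finset.prod_ne_zero_iff.2 fun x _ => pow_ne_zero _ (h3.1 x))
  · rintro ⟨p, q, hq, hpq⟩
    refine ⟨_, RegAt.mul (regAt_eval_params hh p) (RegAt.inv (regAt_eval_params hh q) hq), ?_⟩
    filter_upwards [hpq] with y hy
    rw [hy, div_eq_mul_inv]
    rfl

variable (lam) in
/-- The parameters as a chart. -/
def sextupleChart (h₀ : openSextuples) : Chart openSextuples Letter where
  t h := params lam (sextuple h)
  V := parametrised lam
  τ := ofParams lam h₀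
  regAt_iff _ hh f := regAt_openSextuples hh f
  isOpen_ne q := isOpen_parametrised_ne q
  τ_t h hh := by
    refine Subtype.ext ?_
    change sextuple _ = sextuple _
    rw [sextuple_ofParams h₀ hh.2]
    exact funext fun x => conicPoint_params hh x
  tendsto_τ _ hh := tendsto_ofParams h₀ hh
  t_τ _ hh := (eventually_onlyABCMeet hh.2).mono fun _ hv => params_ofParams h₀ hv

theorem onlyABCMeet_of_mem_parametrised {h : openSextuples} (hh : h ∈ parametrised lam) :
    OnlyABCMeet (sextuple h) := by
  rw [← funext (conicPoint_params hh)]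
  exact onlyABCMeet_conicPoint lam hh.2

theorem notMem_centreZ_of_mem_parametrised {h : openSextuples} (hh : h ∈ parametrised lam) :
    h ∉ centreZ :=
  notMem_polydiagonalsOfType (onlyABCMeet_of_mem_parametrised hh) (by decide)

theorem sextuple_eq_iff {h : openSextuples} (hh : h ∈ parametrised lam) (x y : Letter) :
    sextuple h x = sextuple h y ↔ params lam (sextuple h) x = params lam (sextuple h) y := by
  constructor
  · intro h'
    simp only [params, h']
  · intro h'
    rw [← conicPoint_params hh x, h', conicPoint_params hh y]

/-- Type (2,2,1,1) has only two singleton blocks, so only type (3,1,1,1) contributes here. -/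
theorem mem_centreY_iff {h : openSextuples} (hh : h ∈ parametrised lam) : h ∈ centreY ↔
    params lam (sextuple h) Letter.B = params lam (sextuple h) Letter.A ∧
      params lam (sextuple h) Letter.C = params lam (sextuple h) Letter.A := by
  have hg := onlyABCMeet_of_mem_parametrised hh
  rw [← sextuple_eq_iff hh, ← sextuple_eq_iff hh, ← mem_polydiagonalsOfType_iff hg]
  exact or_iff_right (notMem_polydiagonalsOfType hg (by decide))

end Parametrisation

section PascalLine

/-! ### The Pascal line in parameters -/

open scoped Matrix

variable (lam : ℂ)

/-- The line joining the points of the conic with parameters `t` and `u`. -/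
def chord (t u : ℂ) : Fin 3 → ℂ :=
  ![t * u, -((1 - lam * t) * u + (1 - lam * u) * t), (1 - lam * t) * (1 - lam * u)]

/-- A line restricts to the conic as a quadratic polynomial in the parameter, here with roots t and
u. The incidence computations below factor for this reason. -/
theorem chord_dot_vero (t u w : ℂ) : chord lam t u ⬝ᵥ vero lam w = (w - t) * (w - u) := by
  simp [chord, vero, dotProduct, Fin.sum_univ_three]
  ring

theorem cross_vero (t u : ℂ) : crossProduct (vero lam t) (vero lam u) = (u - t) • chord lam t u := by
  funext i
  fin_cases i <;> simp [chord, vero, cross_apply] <;> ring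

/-- Otherwise (w - t)(w - u) would vanish for all w, in particular for w = t + 1 and w = t + 2. -/
theorem chord_ne_zero (t u : ℂ) : chord lam t u ≠ 0 := by
  intro h
  have h1 := fun w => chord_dot_vero lam t u w
  simp only [h, zero_dotProduct, zero_eq_mul, sub_eq_zero] at h1
  have h2 : t + 1 = u := (h1 _).resolve_left (by simp)
  have h3 : t + 2 = u := (h1 _).resolve_left (by simp)
  rw [← h2] at h3
  norm_num at h3

/-- A quadratic polynomial with three roots is zero; `h2`, `h1`, `h0` are its coefficients, and they
determine `v`. -/
theorem eq_zero_of_dot_vero {v : Fin 3 → ℂ} {a b c : ℂ} (hab : a ≠ b) (hac : a ≠ c) (hbc : b ≠ c)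
    (ha : v ⬝ᵥ vero lam a = 0) (hb : v ⬝ᵥ vero lam b = 0) (hc : v ⬝ᵥ vero lam c = 0) : v = 0 := by
  have hab := sub_ne_zero.2 hab
  have hac := sub_ne_zero.2 hac
  have hbc := sub_ne_zero.2 hbc
  simp only [vero, dotProduct, Fin.sum_univ_three, Matrix.cons_val] at ha hb hc
  have h2 : v 2 - lam * v 1 + lam ^ 2 * v 0 = 0 := by
    have : (a - b) * (a - c) * (b - c) * (v 2 - lam * v 1 + lam ^ 2 * v 0) = 0 := by
      linear_combination (b - c) * ha - (a - c) * hb + (a - b) * hc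
    simpa [hab, hac, hbc] using this
  have h1 : v 1 - 2 * lam * v 0 = 0 := by
    have : (a - b) * (v 1 - 2 * lam * v 0) = 0 := by
      linear_combination ha - hb - (a ^ 2 - b ^ 2) * h2
    simpa [hab] using this
  have h0 : v 0 = 0 := by linear_combination ha - a * h1 - a ^ 2 * h2
  have h1' : v 1 = 0 := by linear_combination h1 + 2 * lam * h0
  have h2' : v 2 = 0 := by linear_combination h2 + lam * h1' - lam ^ 2 * h0
  funext i
  fin_cases i
  exacts [h0, h1', h2']

/-- The intersection of two opposite sides in Pascal's theorem. -/
def crossHair (x y : Fin 3 → ℂ) (i j : Fin 3) : Fin 3 → ℂ :=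
  crossProduct (chord lam (x i) (y j)) (chord lam (x j) (y i))

/-- The first coefficient of the Pascal line with respect to the generators `x₀ - x₂`, `x₁ - x₂`
of the ideal of the diagonal. -/
def pascalLeft (x y : Fin 3 → ℂ) : Fin 3 → ℂ := (y 2 - y 1) • chord lam (x 1) (y 0)

/-- The second coefficient of the Pascal line with respect to the generators `x₀ - x₂`, `x₁ - x₂`
of the ideal of the diagonal. -/
def pascalRight (x y : Fin 3 → ℂ) : Fin 3 → ℂ := (y 0 - y 2) • chord lam (x 0) (y 1)

/-- The coordinates of the Pascal line of six points with parameters `x`, `y`. -/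
def pascalLine (x y : Fin 3 → ℂ) : Fin 3 → ℂ :=
  (x 0 - x 2) • pascalLeft lam x y + (x 1 - x 2) • pascalRight lam x y

variable (x y : Fin 3 → ℂ)

/-- Pascal's theorem as a polynomial identity, valid also when parameters coincide. -/
theorem pascalLine_dot_crossHair (i j : Fin 3) : pascalLine lam x y ⬝ᵥ crossHair lam x y i j = 0 := by
  fin_cases i <;> fin_cases j <;>
    simp [pascalLine, pascalLeft, pascalRight, crossHair, chord, cross_apply, dotProduct,
      Fin.sum_univ_three] <;> ring

/-- The join of two of the three points is the Pascal line times the factor x₀ - y₀, which does not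
vanish when A, B, C come together. What remains is the expression that lies in the ideal of the
diagonal. -/
theorem cross_crossHair : crossProduct (crossHair lam x y 0 1) (crossHair lam x y 0 2) =
    (x 0 - y 0) • pascalLine lam x y := by
  funext l
  fin_cases l <;>
    simp [pascalLine, pascalLeft, pascalRight, crossHair, chord, cross_apply] <;> ring

/-- The second summand passes through the point x₀ and drops out; for distinct parameters the
product is non-zero, and so is the line. -/
theorem pascalLine_dot_vero : pascalLine lam x y ⬝ᵥ vero lam (x 0) =
    (x 0 - x 2) * (y 2 - y 1) * ((x 0 - x 1) * (x 0 - y 0)) := by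
  simp only [pascalLine, pascalLeft, pascalRight, add_dotProduct, smul_dotProduct, chord_dot_vero,
    smul_eq_mul]
  ring

theorem crossHair_ne_zero {i j : Fin 3} (h1 : x i ≠ x j) (h2 : x i ≠ y i) :
    crossHair lam x y i j ≠ 0 := by
  intro h
  -- The pairing with the chord of `x i` and w is (y_j - w)(x_i - x_j)(x_i - y_i); the choice w =
  -- y_j - 1 makes the first factor 1.
  have h3 : crossHair lam x y i j ⬝ᵥ chord lam (x i) (y j - 1) = (x i - x j) * (x i - y i) := by
    simp [crossHair, chord, cross_apply, dotProduct, Fin.sum_univ_three]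
    ring
  rw [h, zero_dotProduct, zero_eq_mul, sub_eq_zero, sub_eq_zero] at h3
  exact h3.elim h1 h2

theorem cross_conicPoint {t u : ℂ} (h : t ≠ u) : Projectivization.cross (conicPoint lam t)
    (conicPoint lam u) = Projectivization.mk ℂ (chord lam t u) (chord_ne_zero lam t u) := by
  have h0 : crossProduct (vero lam t) (vero lam u) ≠ 0 := by
    rw [cross_vero]
    exact smul_ne_zero (sub_ne_zero.2 h.symm) (chord_ne_zero lam t u)
  rw [conicPoint, conicPoint, Projectivization.cross_mk_of_cross_ne_zero _ _ h0]
  exact (Projectivization.mk_eq_mk_iff' ℂ _ _ _ _).2 ⟨u - t, (cross_vero lam t u).symm⟩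

theorem cross_cross_conicPoint {i j : Fin 3} (h1 : x i ≠ x j) (h2 : x i ≠ y i) (h3 : x i ≠ y j)
    (h4 : x j ≠ y i) : Projectivization.cross
      (Projectivization.cross (conicPoint lam (x i)) (conicPoint lam (y j)))
      (Projectivization.cross (conicPoint lam (x j)) (conicPoint lam (y i))) =
    Projectivization.mk ℂ (crossHair lam x y i j) (crossHair_ne_zero lam x y h1 h2) := by
  rw [cross_conicPoint lam h3, cross_conicPoint lam h4]
  exact Projectivization.cross_mk_of_cross_ne_zero _ _ (crossHair_ne_zero lam x y h1 h2)

theorem pascalLine_ne_zero (hx : Function.Injective x) (hy : Function.Injective y)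
    (hxy : ∀ i j, x i ≠ y j) : pascalLine lam x y ≠ 0 := by
  intro h
  have h0 := pascalLine_dot_vero lam x y
  rw [h, zero_dotProduct] at h0
  refine (mul_ne_zero (mul_ne_zero ?_ ?_) (mul_ne_zero ?_ ?_)) h0.symm <;> rw [sub_ne_zero]
  exacts [hx.ne (by decide), hy.ne (by decide), hx.ne (by decide), hxy 0 0]

/-- The line `pascalLine` is the only line through the three points of Pascal's theorem. -/
theorem orthogonal_crossHair_iff (hx : Function.Injective x) (hy : Function.Injective y)
    (hxy : ∀ i j, x i ≠ y j) (L : Plane) :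
    (∀ i j, i ≠ j → L.orthogonal (Projectivization.cross
      (Projectivization.cross (conicPoint lam (x i)) (conicPoint lam (y j)))
      (Projectivization.cross (conicPoint lam (x j)) (conicPoint lam (y i))))) ↔
    L = Projectivization.mk ℂ (pascalLine lam x y) (pascalLine_ne_zero lam x y hx hy hxy) := by
  have hcross := fun (i j : Fin 3) (hij : i ≠ j) =>
    cross_cross_conicPoint lam x y (hx.ne hij) (hxy i i) (hxy i j) (hxy j i)
  constructor
  · intro h
    have h1 := h 0 1 (by decide)
    have h2 := h 0 2 (by decide)
    rw [hcross 0 1 (by decide)] at h1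
    rw [hcross 0 2 (by decide)] at h2
    induction L using Projectivization.ind with | h v hv =>
    rw [Projectivization.orthogonal_mk] at h1 h2
    have hs : (x 0 - y 0) • pascalLine lam x y ≠ 0 :=
      smul_ne_zero (sub_ne_zero.2 (hxy 0 0)) (pascalLine_ne_zero lam x y hx hy hxy)
    refine Eq.trans ?_ ((Projectivization.mk_eq_mk_iff' ℂ _ _ hs _).2 ⟨_, rfl⟩)
    -- By the triple product formula, a vector orthogonal to both points is proportional to their
    -- cross product.
    rw [Projectivization.mk_eq_mk_iff_crossProduct_eq_zero, ← cross_crossHair,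
      cross_cross_eq_smul_sub_smul', dotProduct_comm _ v, h1, h2]
    simp
  · rintro rfl i j hij
    rw [hcross i j hij, Projectivization.orthogonal_mk]
    exact pascalLine_dot_crossHair lam x y i j

/-- The linear pencil to which Pascal lines degenerate. -/
def pencilMap : (Fin 2 → ℂ) →ₗ[ℂ] (Fin 3 → ℂ) :=
  (LinearMap.proj 0).smulRight (pascalLeft lam x y) +
    (LinearMap.proj 1).smulRight (pascalRight lam x y)

theorem pencilMap_apply (v : Fin 2 → ℂ) :
    pencilMap lam x y v = v 0 • pascalLeft lam x y + v 1 • pascalRight lam x y := rfl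

variable {x y} {m : ℂ} (hm : ∀ i, x i = m) (hy : Function.Injective y) (hmy : ∀ j, m ≠ y j)

include hm hy hmy

/-- The two chords join m to y₀ and m to y₁, so evaluation at y₁ isolates the first coefficient and
evaluation at y₀ the second. -/
theorem injective_pencilMap : Function.Injective (pencilMap lam x y) := by
  rw [← LinearMap.ker_eq_bot, LinearMap.ker_eq_bot']
  intro v hv
  rw [pencilMap_apply, pascalLeft, pascalRight, hm, hm] at hv
  have h0 := congrArg (· ⬝ᵥ vero lam (y 0)) hv
  have h1 := congrArg (· ⬝ᵥ vero lam (y 1)) hv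
  simp only [add_dotProduct, smul_dotProduct, chord_dot_vero, smul_eq_mul, zero_dotProduct] at h0 h1
  have e01 := sub_ne_zero.2 (hy.ne (by decide : (0 : Fin 3) ≠ 1))
  have e10 := sub_ne_zero.2 (hy.ne (by decide : (1 : Fin 3) ≠ 0))
  have e02 := sub_ne_zero.2 (hy.ne (by decide : (0 : Fin 3) ≠ 2))
  have e21 := sub_ne_zero.2 (hy.ne (by decide : (2 : Fin 3) ≠ 1))
  have m0 := sub_ne_zero.2 (hmy 0).symm
  have m1 := sub_ne_zero.2 (hmy 1).symm
  funext l
  fin_cases l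
  · simpa [e10, e21, m1] using h1
  · simpa [e01, e02, m0] using h0

theorem mem_range_pencilMap (v : Fin 3 → ℂ) :
    v ∈ LinearMap.range (pencilMap lam x y) ↔ v ⬝ᵥ vero lam m = 0 := by
  constructor
  · rintro ⟨w, rfl⟩
    simp [pencilMap_apply, pascalLeft, pascalRight, hm, chord_dot_vero, add_dotProduct,
      smul_dotProduct]
  · intro hv
    have e01 := sub_ne_zero.2 (hy.ne (by decide : (0 : Fin 3) ≠ 1))
    have e10 := sub_ne_zero.2 (hy.ne (by decide : (1 : Fin 3) ≠ 0))
    have e02 := sub_ne_zero.2 (hy.ne (by decide : (0 : Fin 3) ≠ 2))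
    have e21 := sub_ne_zero.2 (hy.ne (by decide : (2 : Fin 3) ≠ 1))
    have m0 := sub_ne_zero.2 (hmy 0).symm
    have m1 := sub_ne_zero.2 (hmy 1).symm
    -- Interpolation: the coefficients are fixed by the values at y₁ and y₀. The difference then
    -- vanishes at the three points m, y₀, y₁ of the conic.
    refine ⟨![(v ⬝ᵥ vero lam (y 1)) / ((y 2 - y 1) * ((y 1 - m) * (y 1 - y 0))),
      (v ⬝ᵥ vero lam (y 0)) / ((y 0 - y 2) * ((y 0 - m) * (y 0 - y 1)))], ?_⟩
    rw [← sub_eq_zero]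
    refine eq_zero_of_dot_vero lam (hmy 0) (hmy 1) (hy.ne (by decide)) ?_ ?_ ?_ <;>
      simp only [pencilMap_apply, pascalLeft, pascalRight, hm, chord_dot_vero, add_dotProduct,
        sub_dotProduct, smul_dotProduct, smul_eq_mul, Matrix.cons_val, hv] <;> field_simp <;> ring

end PascalLine

section Resolution

/-! ### Separatedness -/

/-- Any two points of a projective space lie in a common affine chart, in which their coordinates
can be compared. -/
theorem exists_linear_ne_zero {n : ℕ} {u v : Fin n → ℂ} (hu : u ≠ 0) (hv : v ≠ 0) :
    ∃ Q : MvPolynomial (Fin n) ℂ, Q.IsHomogeneous 1 ∧ eval u Q ≠ 0 ∧ eval v Q ≠ 0 := by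
  obtain ⟨i, hi⟩ := Function.ne_iff.1 hu
  obtain ⟨j, hj⟩ := Function.ne_iff.1 hv
  by_cases hvi : v i = 0
  · by_cases huj : u j = 0
    · exact ⟨X i + X j, (isHomogeneous_X ℂ i).add (isHomogeneous_X ℂ j), by simpa [huj] using hi,
        by simpa [hvi] using hj⟩
    · exact ⟨X j, isHomogeneous_X ℂ j, by simpa using huj, by simpa using hj⟩
  · exact ⟨X i, isHomogeneous_X ℂ i, by simpa using hi, by simpa using hvi⟩

/-- The pullback of `f` is known only on `W`; near `ξ` it is the restriction of a regular function
`F` on all of `Z`, to which `hF` applies. -/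
theorem tendsto_regAt_comp {Z Z' : FunSpace} {W : Set Z} {q : Z → Z'}
    (hq : IsMorphism (Z.sub W) Z' (fun ξ => q ξ.1)) {ξ : Z} (hξ : ξ ∈ W) {l : Filter ℂ} {g : ℂ → Z}
    (hg : Tendsto g l (𝓝 ξ)) (hW : ∀ᶠ ε in l, g ε ∈ W)
    (hF : ∀ F, Z.RegAt F ξ → Tendsto (fun ε => F (g ε)) l (𝓝 (F ξ))) {f : Z' → ℂ}
    (hf : Z'.RegAt f (q ξ)) : Tendsto (fun ε => f (q (g ε))) l (𝓝 (f (q ξ))) := by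
  obtain ⟨F, hFξ, h⟩ := hq.2 ⟨ξ, hξ⟩ f hf
  have h0 : f (q ξ) = F ξ := h.self_of_nhds
  rw [h0]
  refine (hF F hFξ).congr' ?_
  rw [Filter.Eventually, nhds_subtype_eq_comap] at h
  obtain ⟨s, hs, hsub⟩ := mem_comap.1 h
  filter_upwards [hg.eventually hs, hW] with ε h1 h2
  exact (hsub (show (⟨g ε, h2⟩ : W) ∈ _ from h1)).symm

/-- Two morphisms to a projective space that agree along a curve agree at its limit. -/
theorem eq_of_eventually_eq_curve {Z : FunSpace} {n : ℕ} {W W' : Set Z} {q q' : Z → proj n}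
    (hq : IsMorphism (Z.sub W) (proj n) (fun ξ => q ξ.1))
    (hq' : IsMorphism (Z.sub W') (proj n) (fun ξ => q' ξ.1)) {ξ : Z} (hξ : ξ ∈ W) (hξ' : ξ ∈ W')
    {l : Filter ℂ} [l.NeBot] {g : ℂ → Z} (hg : Tendsto g l (𝓝 ξ)) (hW : ∀ᶠ ε in l, g ε ∈ W)
    (hW' : ∀ᶠ ε in l, g ε ∈ W')
    (hF : ∀ F, Z.RegAt F ξ → Tendsto (fun ε => F (g ε)) l (𝓝 (F ξ)))
    (h : ∀ᶠ ε in l, q (g ε) = q' (g ε)) : q ξ = q' ξ := by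
  obtain ⟨Q, hQ, h1, h2⟩ := exists_linear_ne_zero (Projectivization.rep_nonzero (q ξ))
    (Projectivization.rep_nonzero (q' ξ))
  -- The affine coordinates with denominator `Q` are regular at both points, so the two values are
  -- limits of the same function on the curve.
  have hk : ∀ k, Projectivization.rep (q ξ) k / eval (Projectivization.rep (q ξ)) Q =
      Projectivization.rep (q' ξ) k / eval (Projectivization.rep (q' ξ)) Q := by
    intro k
    have hreg : ∀ z : proj n, eval (Projectivization.rep z) Q ≠ 0 → (proj n).RegAt
        (fun z => Projectivization.rep z k / eval (Projectivization.rep z) Q) z := fun z hz =>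
      regAt_proj.2 ⟨1, X k, Q, isHomogeneous_X ℂ k, hQ, hz, by simp⟩
    refine tendsto_nhds_unique (tendsto_regAt_comp hq hξ hg hW hF (hreg _ h1)) ?_
    refine (tendsto_regAt_comp hq' hξ' hg hW' hF (hreg _ h2)).congr' ?_
    filter_upwards [h] with ε hε
    rw [hε]
  have h3 : ∀ z : proj n, z = Projectivization.mk ℂ _ (Projectivization.rep_nonzero z) :=
    fun z => (Projectivization.mk_rep z).symm
  rw [h3 (q ξ), h3 (q' ξ)]
  refine (Projectivization.mk_eq_mk_iff' ℂ _ _ _ _).2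
    ⟨eval (Projectivization.rep (q ξ)) Q / eval (Projectivization.rep (q' ξ)) Q, ?_⟩
  funext k
  have := hk k
  rw [Pi.smul_apply, smul_eq_mul]
  field_simp at this ⊢
  linear_combination -this

/-! ### The resolution near a sextuple with a triple point -/

/-- For each point the denominator is a non-zero polynomial in `lam`; the product of these finitely
many polynomials has a non-root in ℂ. -/
theorem exists_denom_ne_zero {ι : Type} [Fintype ι] (z : ι → Plane) :
    ∃ lam : ℂ, ∀ i, denom lam (z i).rep ≠ 0 := by
  let p : ι → Polynomial ℂ := fun i => Polynomial.C ((z i).rep 0) +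
    Polynomial.C (2 * (z i).rep 1) * Polynomial.X + Polynomial.C ((z i).rep 2) * Polynomial.X ^ 2
  have hp : ∀ i, p i ≠ 0 := by
    intro i h
    refine Projectivization.rep_nonzero (z i) (funext fun k => ?_)
    have h0 := congrArg (Polynomial.coeff · 0) h
    have h1 := congrArg (Polynomial.coeff · 1) h
    have h2 := congrArg (Polynomial.coeff · 2) h
    simp [p, Polynomial.coeff_X, Polynomial.coeff_C] at h0 h1 h2
    fin_cases k
    exacts [h0, h1, h2]
  obtain ⟨lam, h⟩ := Polynomial.exists_eval_ne_zero_of_natDegree_lt_card (∏ i, p i)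
    (Finset.prod_ne_zero_iff.2 fun i _ => hp i) (by
      exact (Cardinal.natCast_lt_aleph0).trans_le (Cardinal.aleph0_le_mk ℂ))
  refine ⟨lam, fun i => ?_⟩
  rw [Polynomial.eval_prod] at h
  have := Finset.prod_ne_zero_iff.1 h i (Finset.mem_univ i)
  simp only [p, Polynomial.eval_add, Polynomial.eval_mul, Polynomial.eval_C, Polynomial.eval_X,
    Polynomial.eval_pow] at this
  simpa only [denom, mul_comm, mul_left_comm, mul_assoc] using this

variable {lam : ℂ}

/-- The chart of the first blow-up. -/
def firstChart {h₀ : openSextuples} (hh : h₀ ∈ parametrised lam) : Chart firstBlowUp Letter :=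
  (sextupleChart lam h₀).blowUp (fun _ hy => notMem_centreZ_of_mem_parametrised hy) hh

variable {h₀ : openSextuples} (hh : h₀ ∈ parametrised lam)

/-- The chart avoids Z, and Y is closed in it, so taking the closure adds nothing. -/
theorem mem_properTransformY_iff {x : firstBlowUp} (hx : x ∈ (firstChart hh).V) :
    x ∈ properTransformY ↔
      (firstChart hh).t x Letter.B = (firstChart hh).t x Letter.A ∧
        (firstChart hh).t x Letter.C = (firstChart hh).t x Letter.A := by
  have hmem : ∀ y ∈ (firstChart hh).V, beta₁ y ∈ centreY ↔
      (firstChart hh).t y Letter.B = (firstChart hh).t y Letter.A ∧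
        (firstChart hh).t y Letter.C = (firstChart hh).t y Letter.A :=
    fun y hy => mem_centreY_iff (lam := lam) hy
  constructor
  · intro hxY
    rw [properTransformY, mem_closure_iff_frequently] at hxY
    have hxV := (firstChart hh).eventually_mem_V hx
    constructor
    · by_contra h
      refine hxY ?_
      filter_upwards [hxV, (firstChart hh).eventually_eval_ne_zero hx
        (q := X Letter.B - X Letter.A) (by simpa [sub_eq_zero] using h)] with y h1 h2 h3
      exact h2 (by simpa [sub_eq_zero] using ((hmem y h1).1 h3.1).1)
    · by_contra h
      refine hxY ?_
      filter_upwards [hxV, (firstChart hh).eventually_eval_ne_zero hx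
        (q := X Letter.C - X Letter.A) (by simpa [sub_eq_zero] using h)] with y h1 h2 h3
      exact h2 (by simpa [sub_eq_zero] using ((hmem y h1).1 h3.1).2)
  · intro h
    exact subset_closure ⟨(hmem x hx).2 h, notMem_centreZ_of_mem_parametrised (lam := lam) hx⟩

/-- Any order of A, B, C is allowed, since the columns of the array determine which letters play the
roles of x₀, x₁, x₂. -/
theorem isDiagonal_properTransformY {i j k : Letter} (hij : i ≠ j) (hik : i ≠ k) (hjk : j ≠ k)
    (hi : i ∈ lettersABC) (hj : j ∈ lettersABC) (hk : k ∈ lettersABC) :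
    (firstChart hh).IsDiagonal properTransformY i j k := by
  refine ⟨hij, hik, hjk, fun x hx => ?_⟩
  rw [mem_properTransformY_iff hh hx]
  simp only [lettersABC, Finset.mem_insert, Finset.mem_singleton] at hi hj hk
  rcases hi with rfl | rfl | rfl <;> rcases hj with rfl | rfl | rfl <;>
    rcases hk with rfl | rfl | rfl <;>
    first
    | exact absurd rfl hij
    | exact absurd rfl hik
    | exact absurd rfl hjk
    | constructor <;> (rintro ⟨h1, h2⟩; simp [h1, h2])

end Resolution

/-! ### The extension of the Pascal map -/

theorem exists_polynomial_chord (lam : ℂ) (u v : Letter) (k : Fin 3) :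
    ∃ p : MvPolynomial Letter ℂ, ∀ t, eval t p = chord lam (t u) (t v) k := by
  refine ⟨(![X u * X v, -((1 - C lam * X u) * X v + (1 - C lam * X v) * X u),
    (1 - C lam * X u) * (1 - C lam * X v)] : Fin 3 → MvPolynomial Letter ℂ) k, fun t => ?_⟩
  fin_cases k <;> simp [chord]

section PascalForm

variable {X : FunSpace} (c : Chart X Letter) {Y : Set X} (lam : ℂ) (xs ys : Fin 3 → Letter)

/-- A coordinate of the Pascal line, as a function in the chart. -/
def pascalForm (k : Fin 3) (z : X) : ℂ :=
  pascalLine lam (fun l => c.t z (xs l)) (fun l => c.t z (ys l)) k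

theorem exists_pascalForm_eq {x : X} (hx : x ∈ c.V) (k : Fin 3) : ∃ a b : X → ℂ,
    X.RegAt a x ∧ X.RegAt b x ∧
    a x = pascalLeft lam (fun l => c.t x (xs l)) (fun l => c.t x (ys l)) k ∧
    b x = pascalRight lam (fun l => c.t x (xs l)) (fun l => c.t x (ys l)) k ∧
    pascalForm c lam xs ys k =
      fun y => a y * c.diff (xs 2) (xs 0) y + b y * c.diff (xs 2) (xs 1) y := by
  obtain ⟨p, hp⟩ := exists_polynomial_chord lam (xs 1) (ys 0) k
  obtain ⟨q, hq⟩ := exists_polynomial_chord lam (xs 0) (ys 1) k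
  refine ⟨fun y => eval (c.t y) ((MvPolynomial.X (ys 2) - MvPolynomial.X (ys 1)) * p),
    fun y => eval (c.t y) ((MvPolynomial.X (ys 0) - MvPolynomial.X (ys 2)) * q),
    c.regAt_eval_t hx _, c.regAt_eval_t hx _, ?_, ?_, ?_⟩
  · simp [hp, pascalLeft]
  · simp [hq, pascalRight]
  · funext y
    simp [hp, hq, pascalForm, pascalLine, pascalLeft, pascalRight, Chart.diff]
    ring

variable {c} (hY : c.IsDiagonal Y (xs 2) (xs 0) (xs 1))

include hY

theorem pascalForm_mem_idealAt {x : X} (hx : x ∈ c.V) (k : Fin 3) :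
    pascalForm c lam xs ys k ∈ X.idealAt Y x := by
  obtain ⟨a, b, ha, hb, -, -, h⟩ := exists_pascalForm_eq c lam xs ys hx k
  rw [h]
  exact Chart.mul_diff_add_mem_idealAt hY hx ha hb

/-- On the blow-up the two differences are replaced by the values of the functional on them, while
the coefficients are evaluated at the base point. -/
theorem rep_pascalForm (ξ : BlowUpPoint X Y) (hx : ξ.base ∈ c.V) :
    (fun k => ξ.dir.rep (pascalForm c lam xs ys k)) =
      pencilMap lam (fun l => c.t ξ.base (xs l)) (fun l => c.t ξ.base (ys l))
        ![ξ.dir.rep (c.diff (xs 2) (xs 0)), ξ.dir.rep (c.diff (xs 2) (xs 1))] := by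
  funext k
  obtain ⟨a, b, ha, hb, ha', hb', h⟩ := exists_pascalForm_eq c lam xs ys hx k
  rw [Chart.rep_eq_of_eq_mul_diff_add hY ξ hx (pascalForm_mem_idealAt lam xs ys hY hx k) ha hb
    (by simp [h]), ha', hb', pencilMap_apply]
  simp [mul_comm]

variable (c Y)

omit hY

/-- The points of the blow-up at which the coordinates of the Pascal line define a point of the
projective plane. -/
def pascalDomain : Set (X.blowUp Y) :=
  {ξ | X.blowDown Y ξ ∈ c.V ∧
    (fun k => (BlowUpPoint.dir ξ).rep (pascalForm c lam xs ys k)) ≠ 0}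

open Classical in
/-- The extension of the Pascal map to the blow-up. -/
def pascalMap (L₀ : proj 3) (ξ : X.blowUp Y) : proj 3 :=
  if h : (fun k => (BlowUpPoint.dir ξ).rep (pascalForm c lam xs ys k)) ≠ 0 then
    (Projectivization.mk ℂ _ h : Plane) else L₀

variable {c Y}

theorem pascalMap_eq (L₀ : proj 3) {ξ : X.blowUp Y} (hξ : ξ ∈ pascalDomain c Y lam xs ys) :
    pascalMap c Y lam xs ys L₀ ξ = (Projectivization.mk ℂ _ hξ.2 : Plane) :=
  dif_pos hξ.2

include hY

theorem isOpen_pascalDomain : IsOpen (pascalDomain c Y lam xs ys) := by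
  have h : pascalDomain c Y lam xs ys = ⋃ k : Fin 3,
      blowUpBasicOpen c.V (pascalForm c lam xs ys) (MvPolynomial.X k) := by
    refine Set.ext fun (ξ : BlowUpPoint X Y) => ⟨?_, fun h => ?_⟩
    · rintro ⟨hV, h0⟩
      obtain ⟨k, hk⟩ := Function.ne_iff.1 h0
      exact Set.mem_iUnion.2 ⟨k, hV, by simpa [BlowUpPoint.value] using hk⟩
    · obtain ⟨k, hV, hk⟩ := Set.mem_iUnion.1 h
      exact ⟨hV, fun h0 => hk (by simpa [BlowUpPoint.value] using congrFun h0 k)⟩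
  rw [h]
  exact isOpen_iUnion fun k => isOpen_blowUpBasicOpen c.isOpen_V
    (fun y hy l => pascalForm_mem_idealAt lam xs ys hY hy l) (isHomogeneous_X ℂ k)

theorem isMorphism_pascalMap (L₀ : proj 3) :
    IsMorphism ((X.blowUp Y).sub (pascalDomain c Y lam xs ys)) (proj 3)
      (fun ξ => pascalMap c Y lam xs ys L₀ ξ.1) :=
  isMorphism_mk_rep c.isOpen_V (fun _ hy k => pascalForm_mem_idealAt lam xs ys hY hy k)
    (fun _ hξ => hξ.1) fun ξ => ⟨ξ.2.2, pascalMap_eq lam xs ys L₀ ξ.2⟩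

omit hY in
/-- Away from the diagonal the extension is the Pascal line. -/
theorem pascalMap_eq_pascalLine (L₀ : proj 3) {ξ : X.blowUp Y}
    (hξ : ξ ∈ pascalDomain c Y lam xs ys) (hoff : ∀ᶠ y in 𝓝 (X.blowDown Y ξ), y ∉ Y) :
    ∃ h, pascalMap c Y lam xs ys L₀ ξ = (Projectivization.mk ℂ
      (pascalLine lam (fun l => c.t (X.blowDown Y ξ) (xs l))
        (fun l => c.t (X.blowDown Y ξ) (ys l))) h : Plane) := by
  obtain ⟨a, ha, h⟩ := c.rep_eq_of_eventually_notMem ξ hξ.1 hoff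
  have hreg : ∀ k, X.RegAt (pascalForm c lam xs ys k) (BlowUpPoint.base ξ) := by
    intro k
    obtain ⟨p, q, hp, hq, -, -, h⟩ := exists_pascalForm_eq c lam xs ys hξ.1 k
    rw [h]
    have h' : ∀ l, X.RegAt (c.diff (xs 2) l) (X.blowDown Y ξ) := fun l =>
      c.regAt_of_eventually hξ.1
        (c.regAt_eval_t hξ.1 (MvPolynomial.X l - MvPolynomial.X (xs 2))) (by simp [Chart.diff])
    exact c.regAt_add hξ.1 (c.regAt_mul hξ.1 hp (h' _)) (c.regAt_mul hξ.1 hq (h' _))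
  have heq : (fun k => (BlowUpPoint.dir ξ).rep (pascalForm c lam xs ys k)) =
      a • pascalLine lam (fun l => c.t (X.blowDown Y ξ) (xs l))
        (fun l => c.t (X.blowDown Y ξ) (ys l)) :=
    funext fun k => h _ (hreg k)
  have hne := hξ.2
  rw [heq] at hne
  refine ⟨fun h0 => hne (by rw [h0, smul_zero]), ?_⟩
  rw [pascalMap_eq lam xs ys L₀ hξ]
  exact (Projectivization.mk_eq_mk_iff' ℂ _ _ _ _).2 ⟨a, heq.symm⟩

/-- The fibre over a point of the diagonal is mapped isomorphically onto a pencil of lines. -/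
theorem exists_iso_pencil {x : X} (hx : x ∈ c.V) (hxY : x ∈ Y) {S : Set (X.blowUp Y)}
    (hS : ∀ ξ, ξ ∈ S ↔ X.blowDown Y ξ = x) (L₀ : proj 3) {m : ℂ} (hm : ∀ l, c.t x (xs l) = m)
    (hy : Function.Injective fun l => c.t x (ys l)) (hmy : ∀ l, m ≠ c.t x (ys l)) :
    S ⊆ pascalDomain c Y lam xs ys ∧
      ∃ e : Iso ((X.blowUp Y).sub S) ((proj 3).sub (pencil (conicPoint lam m))),
        ∀ ξ : S, (e.toEquiv ξ).1 = pascalMap c Y lam xs ys L₀ ξ.1 := by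
  have hT := injective_pencilMap lam hm hy hmy
  have hbase : ∀ ξ : S, BlowUpPoint.base ξ.1 = x := fun ξ => (hS _).1 ξ.2
  have hrep : ∀ ξ : S, (fun k => (BlowUpPoint.dir ξ.1).rep (pascalForm c lam xs ys k)) =
      pencilMap lam (fun l => c.t x (xs l)) (fun l => c.t x (ys l))
        ![(BlowUpPoint.dir ξ.1).rep (c.diff (xs 2) (xs 0)),
          (BlowUpPoint.dir ξ.1).rep (c.diff (xs 2) (xs 1))] := by
    intro ξ
    have h := rep_pascalForm lam xs ys hY ξ.1 (by rw [hbase]; exact hx)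
    rwa [hbase] at h
  obtain ⟨e, he⟩ := Chart.exists_iso_fibre hY hx hxY hS
  have hsub : S ⊆ pascalDomain c Y lam xs ys := by
    intro ξ hξ
    refine ⟨by rw [(hS ξ).1 hξ]; exact hx, ?_⟩
    obtain ⟨h0, -⟩ := he ⟨ξ, hξ⟩
    rw [hrep ⟨ξ, hξ⟩]
    exact fun h => h0 (hT (by rw [h, map_zero]))
  obtain ⟨e', he'⟩ := exists_iso_of_injective _ hT (pencil (conicPoint lam m)) (by
    intro v hv
    rw [mem_range_pencilMap lam hm hy hmy]
    exact Projectivization.orthogonal_mk hv (vero_ne_zero lam m))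
  -- The fibre is identified with ℙ¹ by the two generators, and ℙ¹ with the pencil by `pencilMap`;
  -- by `hrep` the composite is the Pascal map.
  refine ⟨hsub, e.trans e', fun ξ => ?_⟩
  obtain ⟨h0, h⟩ := he ξ
  obtain ⟨h0', h'⟩ := he' _ h0
  rw [pascalMap_eq lam xs ys L₀ (hsub ξ.2)]
  change (e'.toEquiv (e.toEquiv ξ)).1 = _
  rw [h, h']
  simp only [hrep ξ]
  rfl

end PascalForm

/-! ### Pascal arrays -/

/-- Exchanging the rows only reverses the order in cross products, which leaves the projective
points unchanged. Hence the row of A, B, C may play the role of x. -/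
theorem isPascalLine_iff_row (s : PascalArray) (r r' : Fin 2) (hr : r ≠ r') (h : Letter → Plane)
    (L : Plane) : IsPascalLine s h L ↔ ∀ i j, i ≠ j →
      L.orthogonal (Projectivization.cross
        (Projectivization.cross (h (s (r, i))) (h (s (r', j))))
        (Projectivization.cross (h (s (r, j))) (h (s (r', i))))) := by
  fin_cases r <;> fin_cases r'
  · exact absurd rfl hr
  · rfl
  · refine forall_congr' fun i => forall_congr' fun j => imp_congr_right fun _ => ?_
    rw [Projectivization.cross_comm (Projectivization.cross _ _),
      Projectivization.cross_comm (h (s (0, i))), Projectivization.cross_comm (h (s (0, j)))]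
    rfl
  · exact absurd rfl hr

theorem exists_rows {s : PascalArray} (hs : ABCInOneRow s) : ∃ r r' : Fin 2, r ≠ r' ∧
    (∀ i, s (r, i) ∈ lettersABC) ∧ (∀ i, s (r', i) ∉ lettersABC) ∧
    ∀ x ∈ lettersABC, ∃ i, s (r, i) = x := by
  obtain ⟨r, hA, hB, hC⟩ := hs
  obtain ⟨r', hr'⟩ := exists_ne r
  have hrow : ∀ x ∈ lettersABC, (s.symm x).1 = r := by
    intro x hx
    simp only [lettersABC, Finset.mem_insert, Finset.mem_singleton] at hx
    rcases hx with rfl | rfl | rfl <;> assumption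
  have hsurj : ∀ x ∈ lettersABC, ∃ i, s (r, i) = x := by
    intro x hx
    refine ⟨(s.symm x).2, ?_⟩
    rw [← hrow x hx]
    exact s.apply_symm_apply x
  refine ⟨r, r', hr'.symm, ?_, ?_, hsurj⟩
  · have hinj : Function.Injective fun i => s (r, i) := fun i j h =>
      congrArg Prod.snd (s.injective h)
    have h1 : lettersABC ⊆ Finset.univ.image fun i => s (r, i) := by
      intro x hx
      obtain ⟨i, hi⟩ := hsurj x hx
      exact Finset.mem_image.2 ⟨i, Finset.mem_univ _, hi⟩
    have h2 := Finset.eq_of_subset_of_card_le h1 (by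
      rw [Finset.card_image_of_injective _ hinj]
      decide)
    intro i
    rw [h2]
    exact Finset.mem_image_of_mem _ (Finset.mem_univ i)
  · intro i hi
    have := hrow _ hi
    rw [s.symm_apply_apply] at this
    exact hr' this

/-- The fibre of the resolution over a sextuple with a triple point, and its image under the
extension of the Pascal map. -/
theorem pascal_resolution {lam : ℂ} {h₀ : openSextuples} (hh : h₀ ∈ parametrised lam)
    (hB : sextuple h₀ Letter.B = sextuple h₀ Letter.A)
    (hC : sextuple h₀ Letter.C = sextuple h₀ Letter.A) (s : PascalArray) (hs : ABCInOneRow s) :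
    Nonempty (Iso (resolution.sub (fibre (sextuple h₀))) (proj 2)) ∧
    (∃ (W : Set resolution) (q : resolution → proj 3),
      fibre (sextuple h₀) ⊆ W ∧ IsPascalMorphismOn s W q) ∧
    ∀ (W : Set resolution) (q : resolution → proj 3),
      fibre (sextuple h₀) ⊆ W → IsPascalMorphismOn s W q →
      ∃ e : Iso (resolution.sub (fibre (sextuple h₀)))
        ((proj 3).sub (pencil (sextuple h₀ Letter.A))),
        ∀ ξ : fibre (sextuple h₀), (e.toEquiv ξ).1 = q ξ.1 := by
  obtain ⟨r, r', hr, hABC, hDEF, hsurj⟩ := exists_rows hs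
  set xs : Fin 3 → Letter := fun i => s (r, i) with hxs
  set ys : Fin 3 → Letter := fun i => s (r', i) with hys
  have hxinj : Function.Injective xs := fun i j h => congrArg Prod.snd (s.injective h)
  have hyinj : Function.Injective ys := fun i j h => congrArg Prod.snd (s.injective h)
  set c := firstChart hh with hc
  have hY : c.IsDiagonal properTransformY (xs 2) (xs 0) (xs 1) :=
    isDiagonal_properTransformY hh (hxinj.ne (by decide)) (hxinj.ne (by decide))
      (hxinj.ne (by decide)) (hABC _) (hABC _) (hABC _)
  -- The only point of the first blow-up over `h₀`, which lies off Z; by `hS` the fibre of `beta`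
  -- over `h₀` is the fibre of `beta₂` over this point.
  let x₀ : firstBlowUp := (sextupleChart lam h₀).section_
    (fun _ hy => notMem_centreZ_of_mem_parametrised hy) hh h₀
  have hx₀b : beta₁ x₀ = h₀ := Chart.blowDown_section _ _ _ hh
  have hx₀ : x₀ ∈ c.V := by
    change beta₁ x₀ ∈ parametrised lam
    rwa [hx₀b]
  have ht : c.t x₀ = params lam (sextuple h₀) := by
    change params lam (sextuple (beta₁ x₀)) = _
    rw [hx₀b]
  have hx₀Y : x₀ ∈ properTransformY := by
    rw [mem_properTransformY_iff hh hx₀, ← hc, ht, ← sextuple_eq_iff hh, ← sextuple_eq_iff hh]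
    exact ⟨hB, hC⟩
  have hS : ∀ ξ : resolution, ξ ∈ fibre (sextuple h₀) ↔
      firstBlowUp.blowDown properTransformY ξ = x₀ := by
    intro ξ
    constructor
    · intro hξ
      have hb : beta ξ = h₀ := Subtype.ext hξ
      have hb' : BlowUpPoint.base (beta₂ ξ) = BlowUpPoint.base x₀ := hb.trans hx₀b.symm
      have hV : BlowUpPoint.base x₀ ∈ (sextupleChart lam h₀).V := hx₀
      exact (sextupleChart lam h₀).eq_of_base_eq hb' hV
        (((sextupleChart lam h₀).eventually_mem_V hV).mono
          fun _ hy => notMem_centreZ_of_mem_parametrised hy)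
    · intro hξ
      change sextuple (beta₁ (firstBlowUp.blowDown properTransformY ξ)) = _
      rw [hξ, hx₀b]
  set m := params lam (sextuple h₀) Letter.A with hm
  have hxm : ∀ l, c.t x₀ (xs l) = m := by
    intro l
    rw [ht, hm, ← sextuple_eq_iff hh]
    have := hABC l
    simp only [lettersABC, Finset.mem_insert, Finset.mem_singleton] at this
    rcases this with h | h | h <;> rw [hxs] <;> simp only [h, hB, hC]
  have honly : ∀ {z}, z ∈ c.V → OnlyABCMeet (c.t z) := fun hz => hz.2
  have hyt : ∀ {z}, z ∈ c.V → Function.Injective fun l => c.t z (ys l) := by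
    intro z hz i j hij
    by_contra hne
    exact honly hz _ _ (hyinj.ne hne) (fun h' => hDEF i h'.1) hij
  have hxyt : ∀ {z}, z ∈ c.V → ∀ i j, c.t z (xs i) ≠ c.t z (ys j) := by
    intro z hz i j
    exact honly hz _ _ (fun h' : s (r, i) = s (r', j) => hDEF j (h' ▸ hABC i))
      (fun h' => hDEF j h'.2)
  have hiso := exists_iso_pencil lam xs ys hY hx₀ hx₀Y hS
    (sextuple h₀ Letter.A : proj 3) hxm (hyt hx₀) (fun l => hxm 0 ▸ hxyt hx₀ 0 l)
  rw [show conicPoint lam m = sextuple h₀ Letter.A from conicPoint_params hh Letter.A] at hiso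
  obtain ⟨hsub, e, he⟩ := hiso
  set q₀ : resolution → proj 3 :=
    pascalMap c properTransformY lam xs ys (sextuple h₀ Letter.A : proj 3) with hq₀
  have htinj : ∀ ξ : resolution, beta₂ ξ ∈ c.V → (Function.Injective (sextuple (beta ξ)) ↔
      Function.Injective (c.t (beta₂ ξ))) := fun ξ hξ =>
    forall_congr' fun x => forall_congr' fun y =>
      imp_congr_left (sextuple_eq_iff (lam := lam) hξ x y)
  have hPascal : ∀ ξ : resolution, beta₂ ξ ∈ c.V → Function.Injective (sextuple (beta ξ)) →
      ∃ h, ∀ L, IsPascalLine s (sextuple (beta ξ)) L ↔ L = Projectivization.mk ℂ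
        (pascalLine lam (fun l => c.t (beta₂ ξ) (xs l)) (fun l => c.t (beta₂ ξ) (ys l))) h := by
    intro ξ hξ hinj
    have hx : Function.Injective fun l => c.t (beta₂ ξ) (xs l) :=
      ((htinj ξ hξ).1 hinj).comp hxinj
    refine ⟨pascalLine_ne_zero lam _ _ hx (hyt hξ) (hxyt hξ), fun L => ?_⟩
    rw [isPascalLine_iff_row s r r' hr, ← orthogonal_crossHair_iff lam _ _ hx (hyt hξ) (hxyt hξ)]
    have hpt : ∀ x, conicPoint lam (c.t (beta₂ ξ) x) = sextuple (beta ξ) x :=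
      conicPoint_params (lam := lam) hξ
    simp only [hpt]
    rfl
  have hq₀P : IsPascalMorphismOn s (pascalDomain c properTransformY lam xs ys) q₀ := by
    refine ⟨isOpen_pascalDomain lam xs ys hY, isMorphism_pascalMap lam xs ys hY _, ?_⟩
    intro ξ hξ hinj
    have hV : beta₂ ξ ∈ c.V := hξ.1
    -- Injective sextuples lie off the diagonal, so there the extension is given by `pascalLine`.
    have hoff : beta₂ ξ ∉ properTransformY := fun h =>
      (hxinj.ne (by decide : (0 : Fin 3) ≠ 2))
        ((htinj ξ hV).1 hinj ((hY.mem_iff _ hV).1 h).1)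
    obtain ⟨h0, h1⟩ := pascalMap_eq_pascalLine lam xs ys (sextuple h₀ Letter.A : proj 3) hξ
      (Chart.eventually_notMem hY hV hoff)
    obtain ⟨_, h2⟩ := hPascal ξ hV hinj
    exact (h2 _).2 h1
  refine ⟨(Chart.exists_iso_fibre hY hx₀ hx₀Y hS).nonempty, ⟨_, q₀, hsub, hq₀P⟩, ?_⟩
  intro W q hW hq
  refine ⟨e, fun ξ => (he ξ).trans ?_⟩
  have hξ := (hS ξ.1).1 ξ.2
  have hξV : firstBlowUp.blowDown properTransformY ξ.1 ∈ c.V := by rw [hξ]; exact hx₀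
  have hξY : firstBlowUp.blowDown properTransformY ξ.1 ∈ properTransformY := by rw [hξ]; exact hx₀Y
  obtain ⟨a, b, g, hg, hgt, hF⟩ := Chart.exists_curve hY ξ.1 hξV hξY
  have hgW₀ := hg.eventually (hq₀P.1.mem_nhds (hsub ξ.2))
  have hgW := hg.eventually (hq.1.mem_nhds (hW ξ.2))
  refine eq_of_eventually_eq_curve hq₀P.2.1 hq.2.1 (hsub ξ.2) (hW ξ.2) hg hgW₀ hgW hF ?_
  -- The differences of the parameters of A, B, C along the curve are ε(a + ε), ε(b + 2ε) and ε(a -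
  -- b - ε), up to order and sign. All are non-zero for small ε ≠ 0, so the sextuple is injective.
  filter_upwards [hgt, hgW₀, hgW, eventually_mul_add_ne_zero a one_ne_zero,
    eventually_mul_add_ne_zero b two_ne_zero,
    eventually_mul_add_ne_zero (a - b) (neg_ne_zero.2 one_ne_zero)] with ε ⟨h1, h2⟩ h3 h4 h5 h6 h7
  obtain ⟨h8, h9⟩ := Chart.curve_sub a b hY hξV hξY ε
  rw [← h2] at h8 h9
  have hinj : Function.Injective (sextuple (beta (g ε))) := by
    rw [htinj _ h1]
    have h02 : c.t (beta₂ (g ε)) (xs 0) - c.t (beta₂ (g ε)) (xs 2) ≠ 0 := by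
      refine ne_of_eq_of_ne h8 ?_
      simpa using h5
    have h12 : c.t (beta₂ (g ε)) (xs 1) - c.t (beta₂ (g ε)) (xs 2) ≠ 0 :=
      ne_of_eq_of_ne h9 h6
    have h01 : c.t (beta₂ (g ε)) (xs 0) - c.t (beta₂ (g ε)) (xs 1) ≠ 0 := by
      refine ne_of_eq_of_ne ((sub_sub_sub_cancel_right _ _ _).symm.trans
        (congrArg₂ (· - ·) h8 h9)) (ne_of_eq_of_ne ?_ h7)
      ring
    have hrow : ∀ i j, i ≠ j → c.t (beta₂ (g ε)) (xs i) ≠ c.t (beta₂ (g ε)) (xs j) := by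
      rw [sub_ne_zero] at h02 h12 h01
      intro i j hij
      fin_cases i <;> fin_cases j <;>
        first
        | exact absurd rfl hij
        | assumption
        | (apply Ne.symm; assumption)
    intro x y hxy
    by_contra hne
    refine honly h1 x y hne ?_ hxy
    rintro ⟨hx, hy⟩
    obtain ⟨i, rfl⟩ := hsurj x hx
    obtain ⟨j, rfl⟩ := hsurj y hy
    exact hrow i j (fun h => hne (by rw [h])) hxy
  obtain ⟨_, hu⟩ := hPascal (g ε) h1 hinj
  -- Both extensions give the unique Pascal line of the injective sextuple under `g ε`.
  exact ((hu _).1 (hq₀P.2.2 _ h3 hinj)).trans ((hu _).1 (hq.2.2 _ h4 hinj)).symm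

end PascalResolution

end

theorem mainTheorem4
    (h : Letter → Plane) (M P Q R : Plane)
    (hM : M ∈ conic) (hP : P ∈ conic) (hQ : Q ∈ conic) (hR : R ∈ conic)
    (hMP : M ≠ P) (hMQ : M ≠ Q) (hMR : M ≠ R) (hPQ : P ≠ Q) (hPR : P ≠ R) (hQR : Q ≠ R)
    (hA : h Letter.A = M) (hB : h Letter.B = M) (hC : h Letter.C = M)
    (hD : h Letter.D = P) (hE : h Letter.E = Q) (hF : h Letter.F = R)
    (s : PascalArray) (hs : ABCInOneRow s) :
    Nonempty (Iso (resolution.sub (fibre h)) (proj 2)) ∧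
    (∃ (W : Set resolution) (q : resolution → proj 3),
      fibre h ⊆ W ∧ IsPascalMorphismOn s W q) ∧
    ∀ (W : Set resolution) (q : resolution → proj 3),
      fibre h ⊆ W → IsPascalMorphismOn s W q →
      ∃ e : Iso (resolution.sub (fibre h)) ((proj 3).sub (pencil M)),
        ∀ ξ : fibre h, (e.toEquiv ξ).1 = q ξ.1 := by
  have hc : ∀ x, h x ∈ conic := by
    intro x
    cases x <;> simpa only [hA, hB, hC, hD, hE, hF]
  have honly : OnlyABCMeet h := by
    intro x y hxy hxyABC
    cases x <;> cases y <;>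
      first
      | exact absurd rfl hxy
      | exact absurd (by decide) hxyABC
      | (simp only [hA, hB, hC, hD, hE, hF]; first | assumption | (apply Ne.symm; assumption))
  -- The point of the conic omitted by the parametrisation is chosen away from M, P, Q, R.
  obtain ⟨lam, hlam⟩ := exists_denom_ne_zero h
  let h₀ : openSextuples := (⟨h, mem_openSextuples honly hc⟩ : Subtype _)
  have hh : h₀ ∈ parametrised lam := by
    refine ⟨hlam, fun x y h1 h2 h3 => honly x y h1 h2 ?_⟩
    rw [← conicPoint_param (hc x) (hlam x), ← conicPoint_param (hc y) (hlam y)]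
    exact congrArg (conicPoint lam) h3
  have key := pascal_resolution hh (hB.trans hA.symm) (hC.trans hA.symm) s hs
  rw [show sextuple h₀ = h from rfl, hA] at key
  exact key
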